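/- Fix $n\ge 0$ and write $\binom{[n]}{3}$ for the set of 3-element subsets of $[n]=\{1,\dots,n\}$. A set $X\subseteq\binom{[n]}{3}$ is *closed* if for all $a\in[n]$ and $i<j<k$ in $[n]\setminus\{a\}$, $\{a,i,j\}\in X$ and $\{a,j,k\}\in X$ imply $\{a,i,k\}\in X$; it is *consistent* if both $X$ and $\binom{[n]}{3}\setminus X$ are closed. $B(n,2)$ is the collection of consistent sets, and $\overline{X}$ is the smallest closed set containing $X$. For $X\subseteq Y$ in $B(n,2)$ let $\mathrm{Asc}(X,Y)=\{I\in Y\setminus X: X\cup\{I\}\in B(n,2)\}$. A *wiring diagram* is a family of continuous piecewise linear curves (wires) $C_1,\dots,C_n$ in $\mathbb{R}^2$ such that each $C_i$ projects bijectively to the first coordinate, the wires are in order $C_1,\dots,C_n$ from top to bottom sufficiently far to the right, any two distinct wires meet in exactly one point, and all crossings are transverse. It is *simple* if no three wires have a common point. Its *inversion set* is the set of triples $\{i<j<k\}$ such that the crossing of $C_i$ and $C_k$ lies below $C_j$. The *height* of a triple $\{i<j<k\}$ outside the inversion set is the number of wires that pass below the segment of $C_j$ between $C_i\cap C_j$ and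 $C_j\cap C_k$. **Proposition.** Let $W$ be a simple wiring diagram with inversion set $X$, and let $Y\in B(n,2)$ with $X\subsetneq Y$. Let $I_0\in\mathrm{Asc}(X,Y)$ be of maximum height in $W$ among the elements of $\mathrm{Asc}(X,Y)$. Then for every $\mathcal{I}\subseteq\mathrm{Asc}(X,Y)$ such that $X\cup\overline{\mathcal{I}}$ is consistent, $X\cup\overline{\mathcal{I}\cup\{I_0\}}$ is also consistent. Moreover, let $\Delta$ be the simplicial complex whose faces are the nonempty sets $\mathcal{I}\subseteq\mathrm{Asc}(X,Y)$ such that $X\cup\overline{\mathcal{J}}$ is consistent for every $\mathcal{J}\subseteq\mathcal{I}$. Then $I_0$ is a cone point of $\Delta$: $\{I_0\}$ is a face, and $\mathcal{I}\cup\{I_0\}$ is a face whenever $\mathcal{I}$ is. -/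

import Mathlib

open Filter Topology

/-! ### Consistent families of subsets, ascents -/

/-- The `k`-element subsets of an `n`-element linearly ordered ground set. -/
def kSubsets (n k : ℕ) : Set (Finset (Fin n)) := {I | I.card = k}

/-- A family `X` of `(d+1)`-subsets is closed if, for every `(d-1)`-subset `I` and all `i < j < k`
outside `I`, `I ∪ {i,j} ∈ X` and `I ∪ {j,k} ∈ X` imply `I ∪ {i,k} ∈ X`. -/
def IsClosedFamily {n : ℕ} (d : ℕ) (X : Set (Finset (Fin n))) : Prop :=
  X ⊆ kSubsets n (d + 1) ∧
    ∀ (I : Finset (Fin n)) (i j k : Fin n), I.card + 1 = d → i ∉ I → j ∉ I → k ∉ I →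
      i < j → j < k → I ∪ {i, j} ∈ X → I ∪ {j, k} ∈ X → I ∪ {i, k} ∈ X

/-- The smallest closed family of `(d+1)`-subsets containing `X`. -/
def familyClosure {n : ℕ} (d : ℕ) (X : Set (Finset (Fin n))) : Set (Finset (Fin n)) :=
  ⋂₀ {Z | IsClosedFamily d Z ∧ X ⊆ Z}

/-- A family of `(d+1)`-subsets is consistent if it and its complement are closed. -/
def IsConsistent {n : ℕ} (d : ℕ) (X : Set (Finset (Fin n))) : Prop :=
  IsClosedFamily d X ∧ IsClosedFamily d (kSubsets n (d + 1) \ X)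

/-- The underlying set of the higher Bruhat order `B(n,d)`. -/
def higherBruhat (n d : ℕ) : Set (Set (Finset (Fin n))) := {X | IsConsistent d X}

/-- The ascent set `Asc(X,Y) = {I ∈ Y \ X : X ∪ {I} ∈ B(n,d)}`. -/
def ascents {n : ℕ} (d : ℕ) (X Y : Set (Finset (Fin n))) : Set (Finset (Fin n)) :=
  {I | I ∈ Y \ X ∧ X ∪ {I} ∈ higherBruhat n d}

/-! ### Wiring diagrams -/

/-- Continuous piecewise linear functions on the line: off a locally finite set `S` of
breakpoints the function is affine. -/
def IsPiecewiseLinear (f : ℝ → ℝ) : Prop :=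
  Continuous f ∧ ∃ S : Set ℝ, (∀ a b : ℝ, (S ∩ Set.Icc a b).Finite) ∧
    ∀ a b : ℝ, a < b → Disjoint S (Set.Ioo a b) →
      ∃ m c : ℝ, ∀ x ∈ Set.Ioo a b, f x = m * x + c

/-- A wiring diagram with `n` wires. A plane curve which projects bijectively to the first
coordinate is the graph of a function, so the `i`-th wire is the graph of `wire i`. -/
structure WiringDiagram (n : ℕ) where
  /-- the height function of each wire -/
  wire : Fin n → ℝ → ℝ
  piecewiseLinear : ∀ i, IsPiecewiseLinear (wire i)
  /-- far to the right the wires are ordered top to bottom -/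
  order_right : ∀ i j, i < j → ∀ᶠ x in atTop, wire j x < wire i x
  /-- distinct wires meet in exactly one point -/
  existsUnique_crossing : ∀ i j, i ≠ j → ∃! x, wire i x = wire j x
  /-- at a common point the two wires really change sides -/
  transverse : ∀ i j x, i ≠ j → wire i x = wire j x →
    ((∀ᶠ y in 𝓝[<] x, wire i y < wire j y) ∧ (∀ᶠ y in 𝓝[>] x, wire j y < wire i y)) ∨
    ((∀ᶠ y in 𝓝[<] x, wire j y < wire i y) ∧ (∀ᶠ y in 𝓝[>] x, wire i y < wire j y))

namespace WiringDiagram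

variable {n : ℕ} (W : WiringDiagram n)

/-- No three wires have a common point. -/
def IsSimple : Prop :=
  ∀ i j k, i ≠ j → j ≠ k → i ≠ k → ∀ x, ¬ (W.wire i x = W.wire j x ∧ W.wire j x = W.wire k x)

/-- The inversion triples `i < j < k`: the crossing of wires `i` and `k` lies below wire `j`. -/
def inversionSet : Set (Finset (Fin n)) :=
  {I | ∃ i j k, i < j ∧ j < k ∧ I = {i, j, k} ∧
    ∃ x, W.wire i x = W.wire k x ∧ W.wire i x < W.wire j x}

/-- The segment of wire `j` between its crossings with wires `i` and `k`. -/
def segment (i j k : Fin n) : Set (ℝ × ℝ) :=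
  {z | z.2 = W.wire j z.1 ∧ ∃ a b, W.wire i a = W.wire j a ∧ W.wire k b = W.wire j b ∧
    z.1 ∈ Set.uIcc a b}

/-- The height of a triple `i < j < k`: the number of wires passing below its floor, the segment
of wire `j` between its crossings with `i` and `k`. -/
noncomputable def height (I : Finset (Fin n)) : ℕ :=
  {p : Fin n | ∃ i j k, i < j ∧ j < k ∧ I = {i, j, k} ∧
    ∀ z ∈ W.segment i j k, W.wire p z.1 < z.2}.ncard

end WiringDiagram

/-! ### The complex of consistent ascent subsets -/

/-- The simplicial complex on `Asc(X,Y)` whose faces are the nonempty sets of ascents all of whose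
subsets `τ` have `X ∪ closure τ` consistent. -/
def ascentComplex {n : ℕ} (d : ℕ) (X Y : Set (Finset (Fin n))) :
    PreAbstractSimplicialComplex (Finset (Fin n)) where
  faces := {σ | σ.Nonempty ∧ (σ : Set (Finset (Fin n))) ⊆ ascents d X Y ∧
    ∀ τ ⊆ σ, X ∪ familyClosure d (τ : Set (Finset (Fin n))) ∈ higherBruhat n d}
  isRelLowerSet_faces := fun _ hσ => ⟨hσ.1, fun _ hτσ hτ =>
    ⟨hτ, fun _ hx => hσ.2.1 (hτσ hx), fun ρ hρ => hσ.2.2 ρ (hρ.trans hτσ)⟩⟩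

/-- A cone point of a simplicial complex: a vertex that can be added to every face. -/
def IsConePoint {V : Type*} [DecidableEq V] (K : PreAbstractSimplicialComplex V) (v : V) : Prop :=
  {v} ∈ K.faces ∧ ∀ σ ∈ K.faces, insert v σ ∈ K.faces

/-! A simple diagram is read as a pseudoline arrangement. A triple i < j < k outside X is a triangle
whose floor lies on j and whose apex is the crossing of i and k; the ascents are the triangles of Y
that no other wire enters (`isFlip_iff`).

Let S consist of the flips in 𝓘 ∪ {I₀}. A chain is a set of wires whose consecutive triples all lie
in S. Because the floors are uncut, every wire of a chain passes on or above each crossing of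
consecutive wires (`le_at_consecutive`), so the lower envelope lists the chain in increasing order.
A wire outside the chain passes above all these crossings or below all of them (`hi_or_lo`).
Overlapping chains agree on their overlap (`chains_agree`), which makes the relation `Spanned`
closed; it therefore bounds the closure of 𝓘 from above.

Extend I₀ to a maximal chain V. Then X ∪ closure(𝓘 ∪ {I₀}) is X ∪ closure(𝓘) together with all
triples in V: closedness produces these triples from the consecutive ones (`of_consecutive`), and
the resulting set is consistent (`isConvexRel_union_chain`). Consistency only needs checking on
four-element sets having three elements in V. The fourth wire q does not separate the crossings of
V. Its side then decides the required memberships through X, except where q could prolong a chain;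
maximality of V rules this out.

Maximum height is what prevents q from separating crossings (`above_of_hi`). If q passed above the
consecutive crossings but not above some crossing of V, the wires cutting off that apex would have a
lower envelope containing a triangle of Y with uncut floor (`exists_smaller_triangle`). Descending
on the number of cutting wires ends at an ascent (`exists_flip`) whose floor lies above everything
below the floor of I₀ and above one wire of V as well, so its height would exceed the maximum. -/

/-! ### Pseudoline arrangements -/

/-- A simple arrangement of graphs of functions `f a`, such that for `a < b` the graph of `f a` runs
below the graph of `f b` to the left of `c a b` and above it to the right of `c a b`. -/
structure Pseudolines (ι : Type*) [LinearOrder ι] where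
  f : ι → ℝ → ℝ
  c : ι → ι → ℝ
  lt_iff : ∀ {a b}, a < b → ∀ x, f a x < f b x ↔ x < c a b
  gt_iff : ∀ {a b}, a < b → ∀ x, f b x < f a x ↔ c a b < x
  simple : ∀ {i j k}, i ≠ j → j ≠ k → i ≠ k → ∀ x, f i x = f j x → f j x ≠ f k x

namespace Pseudolines

variable {ι : Type*} [LinearOrder ι] (A : Pseudolines ι)

theorem le_iff {a b : ι} (h : a < b) (x : ℝ) : A.f a x ≤ A.f b x ↔ x ≤ A.c a b := by
  rw [← not_lt, A.gt_iff h, not_lt]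

theorem ge_iff {a b : ι} (h : a < b) (x : ℝ) : A.f b x ≤ A.f a x ↔ A.c a b ≤ x := by
  rw [← not_lt, A.lt_iff h, not_lt]

theorem f_c {a b : ι} (h : a < b) : A.f a (A.c a b) = A.f b (A.c a b) :=
  le_antisymm ((A.le_iff h _).2 le_rfl) ((A.ge_iff h _).2 le_rfl)

/-- Two pseudolines cross once, so the region where one is below the other is a ray, hence convex.
-/
theorem between {p q : ι} {x y z : ℝ} (hx : x ≤ z) (hy : z ≤ y) (h₁ : A.f p x < A.f q x)
    (h₂ : A.f p y < A.f q y) : A.f p z < A.f q z := by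
  rcases lt_trichotomy p q with h | h | h
  · rw [A.lt_iff h] at *; linarith
  · subst h; exact absurd h₁ (lt_irrefl _)
  · rw [A.gt_iff h] at *; linarith

theorem c_ne {i j k : ι} (hij : i < j) (hjk : j < k) : A.c i j ≠ A.c j k := fun h =>
  A.simple hij.ne hjk.ne (hij.trans hjk).ne _ (A.f_c hij) (h ▸ A.f_c hjk)

theorem c_lt_of_lt {i j k : ι} (hij : i < j) (hjk : j < k) (h : A.c i j < A.c j k) :
    A.c i j < A.c i k ∧ A.c i k < A.c j k := by
  have hik := hij.trans hjk
  constructor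
  · rw [← A.lt_iff hik, A.f_c hij, A.lt_iff hjk]; exact h
  · rw [← A.gt_iff hik, ← A.f_c hjk, A.gt_iff hij]; exact h

theorem c_gt_of_gt {i j k : ι} (hij : i < j) (hjk : j < k) (h : A.c j k < A.c i j) :
    A.c j k < A.c i k ∧ A.c i k < A.c i j := by
  have hik := hij.trans hjk
  constructor
  · rw [← A.lt_iff hik, ← A.f_c hjk, A.lt_iff hij]; exact h
  · rw [← A.gt_iff hik, A.f_c hij, A.gt_iff hjk]; exact h

/-- The pseudoline `q` passes above the crossing of `a` and `b`. -/
def Above (q a b : ι) : Prop := A.f a (A.c a b) < A.f q (A.c a b)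

theorem lt_of_not_above {q a b : ι} (hab : a < b) (ha : q ≠ a) (hb : q ≠ b) (h : ¬ A.Above q a b) :
    A.f q (A.c a b) < A.f a (A.c a b) := by
  refine lt_of_le_of_ne (not_lt.1 h) fun he => ?_
  exact A.simple ha hab.ne hb _ he (A.f_c hab)

theorem above_iff_left {q a b : ι} (hq : q < a) : A.Above q a b ↔ A.c q a < A.c a b :=
  A.gt_iff hq _

theorem above_iff_right {q a b : ι} (hab : a < b) (hq : b < q) :
    A.Above q a b ↔ A.c a b < A.c b q := by
  rw [Above, A.f_c hab]; exact A.lt_iff hq _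

theorem above_iff_mid {q a b : ι} (haq : a < q) (hqb : q < b) :
    A.Above q a b ↔ A.c q b < A.c a q := by
  rw [Above, A.lt_iff haq]
  constructor
  · intro h
    by_contra hn
    have := A.c_lt_of_lt haq hqb (lt_of_le_of_ne (not_lt.1 hn) (A.c_ne haq hqb))
    linarith
  · intro h
    exact (A.c_gt_of_gt haq hqb h).2

end Pseudolines

/-! ### Consecutive elements of a finite set -/

/-- `a < b` are consecutive elements of `V`. -/
def Consecutive {ι : Type*} [LinearOrder ι] (V : Finset ι) (a b : ι) : Prop :=
  a ∈ V ∧ b ∈ V ∧ a < b ∧ ∀ d ∈ V, d ≤ a ∨ b ≤ d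

namespace Consecutive

variable {ι : Type*} [LinearOrder ι] {V : Finset ι} {a b d : ι}

theorem lt (h : Consecutive V a b) : a < b := h.2.2.1

theorem exists_pred (ha : a ∈ V) (hb : b ∈ V) (hab : a < b) : ∃ d, Consecutive V d b ∧ a ≤ d := by
  have hne : (V.filter (· < b)).Nonempty := ⟨a, by simp [ha, hab]⟩
  have hm := Finset.max'_mem _ hne
  refine ⟨(V.filter (· < b)).max' hne, ⟨(Finset.mem_filter.1 hm).1, hb, (Finset.mem_filter.1 hm).2,
    fun d hd => ?_⟩, Finset.le_max' _ _ (by simp [ha, hab])⟩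
  rcases lt_or_ge d b with h | h
  · exact Or.inl (Finset.le_max' _ _ (by simp [hd, h]))
  · exact Or.inr h

theorem exists_succ (ha : a ∈ V) (hb : b ∈ V) (hab : a < b) : ∃ d, Consecutive V a d ∧ d ≤ b := by
  have hne : (V.filter (a < ·)).Nonempty := ⟨b, by simp [hb, hab]⟩
  have hm := Finset.min'_mem _ hne
  refine ⟨(V.filter (a < ·)).min' hne, ⟨ha, (Finset.mem_filter.1 hm).1, (Finset.mem_filter.1 hm).2,
    fun d hd => ?_⟩, Finset.min'_le _ _ (by simp [hb, hab])⟩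
  rcases lt_or_ge a d with h | h
  · exact Or.inr (Finset.min'_le _ _ (by simp [hd, h]))
  · exact Or.inl h

theorem right_unique (h : Consecutive V a b) (h' : Consecutive V a d) : b = d := by
  rcases h.2.2.2 d h'.2.1 with h1 | h1
  · exact absurd h'.lt (not_lt.2 h1)
  rcases h'.2.2.2 b h.2.1 with h2 | h2
  · exact absurd h.lt (not_lt.2 h2)
  exact le_antisymm h1 h2

theorem induction_iff [Finite ι] {P : ι → ι → Prop}
    (hP : ∀ a b d, Consecutive V a b → Consecutive V b d → (P a b ↔ P b d))
    {a b a' b' : ι} (h : Consecutive V a b) (h' : Consecutive V a' b') (haa : a ≤ a') :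
    P a b ↔ P a' b' := by
  induction a' using WellFoundedLT.induction generalizing b' with
  | ind a' ih =>
    rcases haa.eq_or_lt with rfl | hlt
    · rw [h.right_unique h']
    · obtain ⟨d, hd, had⟩ := exists_pred h.1 h'.1 hlt
      rw [ih d hd.lt hd had]
      exact hP _ _ _ hd h'

end Consecutive

/-- All triples of consecutive elements of `V` satisfy `S`. -/
def IsTripleChain {ι : Type*} [LinearOrder ι] (S : ι → ι → ι → Prop) (V : Finset ι) : Prop :=
  ∀ a b d, Consecutive V a b → Consecutive V b d → S a b d

/-- If `j < k` belong to two chains which agree on `[j, k]`, then the part of the first chain up to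
`k` and the part of the second from `j` on form a chain. -/
theorem IsTripleChain.union {ι : Type*} [LinearOrder ι] {S : ι → ι → ι → Prop} {V V' : Finset ι}
    (h : IsTripleChain S V) (h' : IsTripleChain S V') {j k : ι} (hjk : j < k)
    (hV : ∀ v ∈ V, v ≤ k) (hV' : ∀ v ∈ V', j ≤ v) (hj : j ∈ V) (hk : k ∈ V)
    (hagree : ∀ w, j ≤ w → w ≤ k → (w ∈ V ↔ w ∈ V')) : IsTripleChain S (V ∪ V') := by
  intro a b d hab hbd
  have memV : ∀ x ∈ V ∪ V', x ≤ k → x ∈ V := fun x hx hxk => by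
    rcases Finset.mem_union.1 hx with hx | hx
    · exact hx
    · exact (hagree x (hV' x hx) hxk).2 hx
  have memV' : ∀ x ∈ V ∪ V', j ≤ x → x ∈ V' := fun x hx hxk => by
    rcases Finset.mem_union.1 hx with hx | hx
    · exact (hagree x hxk (hV x hx)).1 hx
    · exact hx
  have ha := hab.1
  have hb := hab.2.1
  have hd := hbd.2.1
  rcases le_or_gt d k with hdk | hdk
  · have hbk := hbd.lt.le.trans hdk
    exact h _ _ _
      ⟨memV a ha (hab.lt.le.trans hbk), memV b hb hbk, hab.lt,
        fun x hx => hab.2.2.2 x (Finset.mem_union_left _ hx)⟩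
      ⟨memV b hb hbk, memV d hd hdk, hbd.lt,
        fun x hx => hbd.2.2.2 x (Finset.mem_union_left _ hx)⟩
  · rcases le_or_gt j a with hja | hja
    · have hjb := hja.trans hab.lt.le
      exact h' _ _ _
        ⟨memV' a ha hja, memV' b hb hjb, hab.lt,
          fun x hx => hab.2.2.2 x (Finset.mem_union_right _ hx)⟩
        ⟨memV' b hb hjb, memV' d hd (hjb.trans hbd.lt.le), hbd.lt,
          fun x hx => hbd.2.2.2 x (Finset.mem_union_right _ hx)⟩
    · exfalso
      have h1 := hab.2.2.2 j (Finset.mem_union_left _ hj)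
      have h3 := hbd.2.2.2 k (Finset.mem_union_left _ hk)
      have h1' : b ≤ j := h1.resolve_left (not_le.2 hja)
      have h3' : k ≤ b := h3.resolve_right (not_le.2 hdk)
      exact absurd hjk (not_lt.2 (h3'.trans h1'))

theorem IsTripleChain.filter_le {ι : Type*} [LinearOrder ι] {S : ι → ι → ι → Prop} {V : Finset ι}
    (h : IsTripleChain S V) (k : ι) : IsTripleChain S (V.filter (· ≤ k)) := by
  have key : ∀ a b, Consecutive (V.filter (· ≤ k)) a b → Consecutive V a b := by
    intro a b hab
    have hb := Finset.mem_filter.1 hab.2.1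
    refine ⟨(Finset.mem_filter.1 hab.1).1, hb.1, hab.lt, fun d hd => ?_⟩
    rcases le_or_gt d k with hdk | hdk
    · exact hab.2.2.2 d (by simp [hd, hdk])
    · exact Or.inr (hb.2.trans hdk.le)
  exact fun a b d hab hbd => h _ _ _ (key _ _ hab) (key _ _ hbd)

theorem IsTripleChain.filter_ge {ι : Type*} [LinearOrder ι] {S : ι → ι → ι → Prop} {V : Finset ι}
    (h : IsTripleChain S V) (k : ι) : IsTripleChain S (V.filter (k ≤ ·)) := by
  have key : ∀ a b, Consecutive (V.filter (k ≤ ·)) a b → Consecutive V a b := by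
    intro a b hab
    have ha := Finset.mem_filter.1 hab.1
    refine ⟨ha.1, (Finset.mem_filter.1 hab.2.1).1, hab.lt, fun d hd => ?_⟩
    rcases le_or_gt k d with hdk | hdk
    · exact hab.2.2.2 d (by simp [hd, hdk])
    · exact Or.inl (hdk.le.trans ha.2)
  exact fun a b d hab hbd => h _ _ _ (key _ _ hab) (key _ _ hbd)

/-! ### The lower envelope of a chain of flips -/

namespace Pseudolines

variable {ι : Type*} [LinearOrder ι] [Finite ι] (A : Pseudolines ι)

/-- All triples `a < b < c` in `S` are not inverted, and no pseudoline crosses their floor, the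
segment of `b` between its crossings with `a` and `c`. -/
def IsFlipRel (S : ι → ι → ι → Prop) : Prop :=
  ∀ a b d, S a b d → a < b ∧ b < d ∧ A.c a b < A.c b d ∧
    ∀ q, q ≠ a → q ≠ b → q ≠ d → (A.Above q a b ↔ A.Above q b d)

variable {A} {S : ι → ι → ι → Prop} {V : Finset ι}

/-- Induction along the chain, away from `w`. At the crossing next to `w` the claim is non-inversion
of a flip; each further step compares the two ends of a floor, which `w` does not cut. -/
theorem le_at_consecutive (hS : A.IsFlipRel S) (hV : IsTripleChain S V) {a b w : ι}
    (hab : Consecutive V a b) (hw : w ∈ V) : A.f a (A.c a b) ≤ A.f w (A.c a b) := by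
  rcases hab.2.2.2 w hw with h | h
  · induction a using WellFoundedLT.induction generalizing b with
    | ind a ih =>
      rcases h.eq_or_lt with rfl | hlt
      · exact le_rfl
      obtain ⟨d, hd, hwd⟩ := Consecutive.exists_pred hw hab.1 hlt
      obtain ⟨h1, h2, h3, h4⟩ := hS _ _ _ (hV _ _ _ hd hab)
      rcases hwd.eq_or_lt with rfl | hwd'
      · exact (A.ge_iff h1 _).2 h3.le
      · have h5 := ih d hd.lt hd hwd
        have h6 : A.Above w d a := by
          by_contra hn
          exact absurd (A.lt_of_not_above h1 hwd'.ne hlt.ne hn) (not_lt.2 h5)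
        exact le_of_lt ((h4 w hwd'.ne hlt.ne (hlt.trans h2).ne).1 h6)
  · rw [A.f_c hab.lt]
    induction b using WellFoundedGT.induction generalizing a with
    | ind b ih =>
      rcases h.eq_or_lt with rfl | hlt
      · exact le_rfl
      obtain ⟨d, hd, hwd⟩ := Consecutive.exists_succ hab.2.1 hw hlt
      obtain ⟨h1, h2, h3, h4⟩ := hS _ _ _ (hV _ _ _ hab hd)
      rcases hwd.eq_or_lt with rfl | hwd'
      · exact (A.le_iff h2 _).2 h3.le
      · have h5 := ih d hd.lt hd hwd
        have h6 : A.Above w b d := by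
          by_contra hn
          have := A.lt_of_not_above h2 hlt.ne' hwd'.ne' hn
          rw [A.f_c h2] at this
          exact absurd this (not_lt.2 h5)
        have := (h4 w (h1.trans hlt).ne' hlt.ne' hwd'.ne').2 h6
        rw [Above, A.f_c h1] at this
        exact this.le

theorem chain_not_inverted (hS : A.IsFlipRel S) (hV : IsTripleChain S V) {i j k : ι}
    (hi : i ∈ V) (hj : j ∈ V) (hk : k ∈ V) (hij : i < j) (hjk : j < k) :
    A.c i j < A.c j k := by
  obtain ⟨d, hd, hid⟩ := Consecutive.exists_pred hi hj hij
  obtain ⟨e, he, hek⟩ := Consecutive.exists_succ hj hk hjk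
  obtain ⟨h1, h2, h3, -⟩ := hS _ _ _ (hV _ _ _ hd he)
  have h4 := le_at_consecutive hS hV hd hi
  have h5 := le_at_consecutive hS hV he hk
  rw [A.f_c h1, A.ge_iff hij] at h4
  rw [A.le_iff hjk] at h5
  linarith

/-- `x` lies between two crossings of consecutive elements of `V`. -/
def InRange (A : Pseudolines ι) (V : Finset ι) (x : ℝ) : Prop :=
  ∃ a b a' b', Consecutive V a b ∧ Consecutive V a' b' ∧ A.c a b ≤ x ∧ x ≤ A.c a' b'

theorem inRange_crossing (hS : A.IsFlipRel S) (hV : IsTripleChain S V) {i k : ι}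
    (hi : i ∈ V) (hk : k ∈ V) (hik : i < k) : A.InRange V (A.c i k) := by
  obtain ⟨d, hd, hid⟩ := Consecutive.exists_pred hi hk hik
  obtain ⟨e, he, hek⟩ := Consecutive.exists_succ hi hk hik
  have h4 := le_at_consecutive hS hV hd hi
  have h5 := le_at_consecutive hS hV he hk
  rw [A.f_c hd.lt, A.ge_iff hik] at h4
  rw [A.le_iff hik] at h5
  exact ⟨_, _, _, _, he, hd, h5, h4⟩

/-- `q` passes above all crossings of consecutive elements of `V`. -/
def Hi (A : Pseudolines ι) (q : ι) (V : Finset ι) : Prop :=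
  ∀ a b, Consecutive V a b → A.f a (A.c a b) < A.f q (A.c a b)

/-- `q` passes below all crossings of consecutive elements of `V`. -/
def Lo (A : Pseudolines ι) (q : ι) (V : Finset ι) : Prop :=
  ∀ a b, Consecutive V a b → A.f q (A.c a b) < A.f a (A.c a b)

/-- Neighbouring crossings are the two ends of an uncut floor, so the side on which `q` passes
propagates along the whole chain. -/
theorem hi_or_lo (hS : A.IsFlipRel S) (hV : IsTripleChain S V) {q : ι} (hq : q ∉ V) :
    A.Hi q V ∨ A.Lo q V := by
  have hne : ∀ v ∈ V, q ≠ v := fun v hv h => hq (h ▸ hv)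
  have hP : ∀ a b d, Consecutive V a b → Consecutive V b d → (A.Above q a b ↔ A.Above q b d) :=
    fun a b d hab hbd => (hS _ _ _ (hV _ _ _ hab hbd)).2.2.2 q (hne _ hab.1) (hne _ hab.2.1)
      (hne _ hbd.2.1)
  by_contra hcon
  rw [not_or] at hcon
  obtain ⟨h1, h2⟩ := hcon
  simp only [Hi, Lo, not_forall] at h1 h2
  obtain ⟨a, b, hab, h1⟩ := h1
  obtain ⟨a', b', hab', h2⟩ := h2
  have h3 : A.Above q a' b' := by
    by_contra hn
    exact h2 (A.lt_of_not_above hab'.lt (hne _ hab'.1) (hne _ hab'.2.1) hn)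
  rcases le_total a a' with h | h
  · exact h1 ((Consecutive.induction_iff hP hab hab' h).2 h3)
  · exact h1 ((Consecutive.induction_iff hP hab' hab h).1 h3)

/-- `w` is a lowest element of `V` at `x`. -/
def IsLowest (A : Pseudolines ι) (V : Finset ι) (w : ι) (x : ℝ) : Prop :=
  w ∈ V ∧ ∀ v ∈ V, A.f w x ≤ A.f v x

theorem exists_isLowest {ι : Type*} [LinearOrder ι] (A : Pseudolines ι) {V : Finset ι} (hne : V.Nonempty) (x : ℝ) : ∃ w, A.IsLowest V w x := by
  obtain ⟨w, hw, h⟩ := V.exists_min_image (fun v => A.f v x) hne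
  exact ⟨w, hw, h⟩

theorem isLowest_left (hS : A.IsFlipRel S) (hV : IsTripleChain S V) {a b : ι}
    (hab : Consecutive V a b) : A.IsLowest V a (A.c a b) :=
  ⟨hab.1, fun _ hv => le_at_consecutive hS hV hab hv⟩

theorem isLowest_right (hS : A.IsFlipRel S) (hV : IsTripleChain S V) {a b : ι}
    (hab : Consecutive V a b) : A.IsLowest V b (A.c a b) :=
  ⟨hab.2.1, fun _ hv => A.f_c hab.lt ▸ le_at_consecutive hS hV hab hv⟩

theorem IsLowest.le_crossing (hS : A.IsFlipRel S) (hV : IsTripleChain S V) {w a b : ι} {x : ℝ}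
    (hw : A.IsLowest V w x) (hab : Consecutive V a b) (h : w ≤ a) : x ≤ A.c a b := by
  rcases h.eq_or_lt with rfl | h
  · exact (A.le_iff hab.lt x).1 (hw.2 b hab.2.1)
  · have h1 := le_at_consecutive hS hV hab hw.1
    have h2 := hw.2 a hab.1
    rw [A.ge_iff h] at h1
    rw [A.le_iff h] at h2
    linarith

theorem IsLowest.crossing_le (hS : A.IsFlipRel S) (hV : IsTripleChain S V) {w a b : ι} {x : ℝ}
    (hw : A.IsLowest V w x) (hab : Consecutive V a b) (h : b ≤ w) : A.c a b ≤ x := by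
  rcases h.eq_or_lt with rfl | h
  · exact (A.ge_iff hab.lt x).1 (hw.2 a hab.1)
  · have h1 := le_at_consecutive hS hV hab hw.1
    have h2 := hw.2 b hab.2.1
    rw [A.f_c hab.lt, A.le_iff h] at h1
    rw [A.ge_iff h] at h2
    linarith

/-- Over `x` the envelope follows one wire `w` between its crossings with its two neighbours. Since
`q` is above `w` at both, it is above `w` in between. -/
theorem Hi.exists_lt (hS : A.IsFlipRel S) (hV : IsTripleChain S V) {q : ι} (hq : A.Hi q V) {x : ℝ}
    (hx : A.InRange V x) : ∃ w ∈ V, A.f w x < A.f q x := by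
  obtain ⟨a, b, a', b', hab, hab', h1, h2⟩ := hx
  obtain ⟨w, hw⟩ := A.exists_isLowest ⟨a, hab.1⟩ x
  rcases hab.2.2.2 w hw.1 with hwa | hwa
  · have := hw.le_crossing hS hV hab hwa
    obtain rfl : x = A.c a b := le_antisymm this h1
    exact ⟨a, hab.1, hq _ _ hab⟩
  rcases hab'.2.2.2 w hw.1 with hwa' | hwa'
  · obtain ⟨d, hd, -⟩ := Consecutive.exists_pred hab.1 hw.1 (hab.lt.trans_le hwa)
    obtain ⟨e, he, -⟩ := Consecutive.exists_succ hw.1 hab'.2.1 (hwa'.trans_lt hab'.lt)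
    refine ⟨w, hw.1, A.between (hw.crossing_le hS hV hd le_rfl) (hw.le_crossing hS hV he le_rfl)
      ?_ (hq _ _ he)⟩
    rw [← A.f_c hd.lt]
    exact hq _ _ hd
  · have := hw.crossing_le hS hV hab' hwa'
    obtain rfl : x = A.c a' b' := le_antisymm h2 this
    exact ⟨a', hab'.1, hq _ _ hab'⟩

theorem Lo.lt (hS : A.IsFlipRel S) (hV : IsTripleChain S V) {q : ι} (hq : A.Lo q V) {x : ℝ}
    (hx : A.InRange V x) {w : ι} (hw : w ∈ V) : A.f q x < A.f w x := by
  obtain ⟨a, b, a', b', hab, hab', h1, h2⟩ := hx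
  exact A.between h1 h2 ((hq _ _ hab).trans_le (le_at_consecutive hS hV hab hw))
    ((hq _ _ hab').trans_le (le_at_consecutive hS hV hab' hw))

/-- `q` belongs to `V` or passes above all crossings of consecutive elements of `V`. -/
def Up (A : Pseudolines ι) (q : ι) (V : Finset ι) : Prop := q ∈ V ∨ A.Hi q V

theorem Up.le (hS : A.IsFlipRel S) (hV : IsTripleChain S V) {q a b : ι} (hq : A.Up q V)
    (hab : Consecutive V a b) : A.f a (A.c a b) ≤ A.f q (A.c a b) :=
  hq.elim (le_at_consecutive hS hV hab) fun h => (h _ _ hab).le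

theorem Up.exists_le (hS : A.IsFlipRel S) (hV : IsTripleChain S V) {q : ι} (hq : A.Up q V) {x : ℝ}
    (hx : A.InRange V x) : ∃ w ∈ V, A.f w x ≤ A.f q x :=
  hq.elim (fun h => ⟨q, h, le_rfl⟩) fun h => by
    obtain ⟨w, hw, hlt⟩ := h.exists_lt hS hV hx
    exact ⟨w, hw, hlt.le⟩

theorem lo_of_not_up (hS : A.IsFlipRel S) (hV : IsTripleChain S V) {q : ι} (hq : ¬ A.Up q V) :
    A.Lo q V := by
  rw [Up, not_or] at hq
  exact (hi_or_lo hS hV hq.1).resolve_left hq.2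

theorem hi_of_above (hS : A.IsFlipRel S) (hV : IsTripleChain S V) {q : ι} (hq : q ∉ V) {x : ℝ}
    (hx : A.InRange V x) {w : ι} (hw : w ∈ V) (h : A.f w x ≤ A.f q x) : A.Hi q V :=
  (hi_or_lo hS hV hq).resolve_right fun hlo => absurd (hlo.lt hS hV hx hw) (not_lt.2 h)

/-! ### The triples spanned by chains -/

/-- The triples `i < j < k` that are not inverted and for which there is a chain from `i` to `k`
that `j` belongs to or passes above. -/
def Spanned (A : Pseudolines ι) (S : ι → ι → ι → Prop) (i j k : ι) : Prop :=
  i < j ∧ j < k ∧ A.c i j < A.c j k ∧ ∃ V, IsTripleChain S V ∧ i ∈ V ∧ k ∈ V ∧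
    (∀ v ∈ V, i ≤ v ∧ v ≤ k) ∧ A.Up j V

/-- The chain `V'` of (i, k, l) also serves (i, j, l). If `j` ran below `V'`, it would be below `l`
at the crossing of k and l, so that crossing would precede the one of j and k. At the last crossing
of `V`, however, `l` is above and `j` is on or above the chain, which gives the opposite order. -/
theorem Spanned.trans_left (hS : A.IsFlipRel S) {i j k l : ι} (h₁ : A.Spanned S i j k)
    (h₃ : A.Spanned S i k l) : A.Spanned S i j l := by
  obtain ⟨hij, hjk, hn, V, hV, hiV, hkV, hVs, hjV⟩ := h₁
  obtain ⟨hik, hkl, hn', V', hV', hiV', hlV', hVs', hkV'⟩ := h₃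
  have hjl := hjk.trans hkl
  have o1 := A.c_lt_of_lt hij hjk hn
  have o2 := A.c_lt_of_lt hik hkl hn'
  have hnl : A.c i j < A.c j l := by
    rw [← A.lt_iff hjl, ← A.f_c hij, A.lt_iff (hij.trans hjl)]
    linarith
  refine ⟨hij, hjl, hnl, V', hV', hiV', hlV', hVs', ?_⟩
  by_contra hup
  have hlo := A.lo_of_not_up hS hV' hup
  obtain ⟨a, ha, -⟩ := Consecutive.exists_pred hiV' hlV' (hij.trans hjl)
  obtain ⟨s, hs, -⟩ := Consecutive.exists_succ hiV' hlV' (hij.trans hjl)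
  have h1 := hkV'.le hS hV' ha
  rw [A.f_c ha.lt, A.ge_iff hkl] at h1
  have h2 := le_at_consecutive hS hV' hs hlV'
  rw [A.le_iff (hij.trans hjl)] at h2
  have h3 : A.InRange V' (A.c k l) := ⟨_, _, _, _, hs, ha, by linarith, h1⟩
  have h4 := hlo.lt hS hV' h3 hlV'
  rw [← A.f_c hkl, A.lt_iff hjk] at h4
  have hlV : l ∉ V := fun h => absurd (hVs l h).2 (not_le.2 hkl)
  have h5 := A.hi_of_above hS hV hlV (A.inRange_crossing hS hV hiV hkV hik) hiV
    ((A.le_iff (hij.trans hjl) _).2 o2.1.le)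
  obtain ⟨b, hb, -⟩ := Consecutive.exists_pred hiV hkV hik
  have h6 := h5 _ _ hb
  rw [A.f_c hb.lt, A.lt_iff hkl] at h6
  have h7 := hjV.le hS hV hb
  rw [A.f_c hb.lt, A.ge_iff hjk] at h7
  linarith

theorem Spanned.trans_right (hS : A.IsFlipRel S) {i j k l : ι} (h₂ : A.Spanned S i j l)
    (h₄ : A.Spanned S j k l) : A.Spanned S i k l := by
  obtain ⟨hij, hjl, hn', V', hV', hiV', hlV', hVs', hjV'⟩ := h₂
  obtain ⟨hjk, hkl, hn, V, hV, hjV, hlV, hVs, hkV⟩ := h₄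
  have hil := hij.trans hjl
  have hik := hij.trans hjk
  have o1 := A.c_lt_of_lt hjk hkl hn
  have o2 := A.c_lt_of_lt hij hjl hn'
  have hnl : A.c i k < A.c k l := by
    rw [← A.gt_iff hik, A.f_c hkl, A.gt_iff hil]
    linarith
  refine ⟨hik, hkl, hnl, V', hV', hiV', hlV', hVs', ?_⟩
  by_contra hup
  have hlo := A.lo_of_not_up hS hV' hup
  obtain ⟨a, ha, -⟩ := Consecutive.exists_succ hiV' hlV' hil
  obtain ⟨s, hs, -⟩ := Consecutive.exists_pred hiV' hlV' hil
  have h1 := hjV'.le hS hV' ha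
  rw [A.le_iff hij] at h1
  have h2 := le_at_consecutive hS hV' hs hiV'
  rw [A.f_c hs.lt, A.ge_iff hil] at h2
  have h3 : A.InRange V' (A.c i j) := ⟨_, _, _, _, ha, hs, h1, by linarith⟩
  have h4 := hlo.lt hS hV' h3 hiV'
  rw [A.f_c hij, A.gt_iff hjk] at h4
  have hiV : i ∉ V := fun h => absurd (hVs i h).1 (not_le.2 hij)
  have h5 := A.hi_of_above hS hV hiV (A.inRange_crossing hS hV hjV hlV hjl) hlV
    ((A.ge_iff hil _).2 o2.2.le)
  obtain ⟨b, hb, -⟩ := Consecutive.exists_succ hjV hlV hjl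
  have h6 := h5 _ _ hb
  rw [A.gt_iff hij] at h6
  have h7 := hkV.le hS hV hb
  rw [A.le_iff hjk] at h7
  linarith

/-- Over the window from the first crossing of `V'` to the last crossing of `V`, a lowest wire of
either chain cannot run below the other chain. The two envelopes therefore coincide there, and over
this window they run through exactly the wires from `j` to `k`. -/
theorem chains_agree (hS : A.IsFlipRel S) {V V' : Finset ι} (hV : IsTripleChain S V)
    (hV' : IsTripleChain S V') {i j k l : ι} (hij : i < j) (hjk : j < k) (hkl : k < l)
    (hn : A.c i j < A.c j k) (hn' : A.c j k < A.c k l) (hiV : i ∈ V) (hkV : k ∈ V)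
    (hVs : ∀ v ∈ V, i ≤ v ∧ v ≤ k) (hjV' : j ∈ V') (hlV' : l ∈ V')
    (hVs' : ∀ v ∈ V', j ≤ v ∧ v ≤ l) (hjV : A.Up j V) (hkV' : A.Up k V') (w : ι) (hjw : j ≤ w)
    (hwk : w ≤ k) : w ∈ V ↔ w ∈ V' := by
  have hik := hij.trans hjk
  have hjl := hjk.trans hkl
  have o1 := A.c_lt_of_lt hij hjk hn
  have o2 := A.c_lt_of_lt hjk hkl hn'
  have hnl : A.c i k < A.c i l := (A.c_lt_of_lt hik hkl (by linarith)).1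
  have hnl' : A.c i l < A.c j l := (A.c_lt_of_lt hij hjl (by linarith)).2
  have hlV : l ∉ V := fun h => absurd (hVs l h).2 (not_le.2 hkl)
  have hiV' : i ∉ V' := fun h => absurd (hVs' i h).1 (not_le.2 hij)
  have hl := A.hi_of_above hS hV hlV (A.inRange_crossing hS hV hiV hkV hik) hiV
    ((A.le_iff (hij.trans hjl) _).2 hnl.le)
  have hi := A.hi_of_above hS hV' hiV' (A.inRange_crossing hS hV' hjV' hlV' hjl) hlV'
    ((A.ge_iff (hij.trans hjl) _).2 hnl'.le)
  obtain ⟨p, hp, -⟩ := Consecutive.exists_pred hiV hkV hik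
  obtain ⟨r, hr, -⟩ := Consecutive.exists_succ hiV hkV hik
  obtain ⟨s, hs, -⟩ := Consecutive.exists_succ hjV' hlV' hjl
  obtain ⟨t, ht, -⟩ := Consecutive.exists_pred hjV' hlV' hjl
  have a1 := hjV.le hS hV hp
  rw [A.f_c hp.lt, A.ge_iff hjk] at a1
  have a2 := hkV'.le hS hV' hs
  rw [A.le_iff hjk] at a2
  have a3 := hl _ _ hp
  rw [A.f_c hp.lt, A.lt_iff hkl] at a3
  have a4 := hkV'.le hS hV' ht
  rw [A.f_c ht.lt, A.ge_iff hkl] at a4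
  have a5 := hi _ _ hs
  rw [A.gt_iff hij] at a5
  have a6 := hjV.le hS hV hr
  rw [A.le_iff hij] at a6
  have hR : ∀ x, A.c j s ≤ x → x ≤ A.c p k → A.InRange V x := fun x h1 h2 =>
    ⟨_, _, _, _, hr, hp, by linarith, h2⟩
  have hR' : ∀ x, A.c j s ≤ x → x ≤ A.c p k → A.InRange V' x := fun x h1 h2 =>
    ⟨_, _, _, _, hs, ht, h1, by linarith⟩
  have lowk := isLowest_right hS hV hp
  have lowj := isLowest_left hS hV' hs
  classical
  have up : ∀ x w, A.c j s ≤ x → x ≤ A.c p k → A.IsLowest V w x → A.Up w V' := by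
    intro x w hx1 hx2 hw
    by_contra hup
    -- Take the last wire `w₁` of `V` that runs below `V'`. Its successor does not run below `V'`,
    -- yet the two meet at a point of the window: a contradiction.
    have hne : (V.filter fun v => ¬ A.Up v V').Nonempty := ⟨w, by simp [hw.1, hup]⟩
    obtain ⟨w₁, hw₁, hmax⟩ := (V.filter fun v => ¬ A.Up v V').exists_max_image id hne
    rw [Finset.mem_filter] at hw₁
    have hww₁ : w ≤ w₁ := hmax w (by simp [hw.1, hup])
    have hw₁k : w₁ < k := lt_of_le_of_ne (hVs _ hw₁.1).2 fun h => hw₁.2 (h ▸ hkV')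
    obtain ⟨w₂, hw₂, hw₂k⟩ := Consecutive.exists_succ hw₁.1 hkV hw₁k
    have hup₂ : A.Up w₂ V' := by
      by_contra hn
      exact absurd (hmax w₂ (by simp [hw₂.2.1, hn])) (not_le.2 hw₂.lt)
    have b1 := hw.le_crossing hS hV hw₂ hww₁
    have b2 := lowk.crossing_le hS hV hw₂ hw₂k
    have b3 := hR' (A.c w₁ w₂) (by linarith) b2
    obtain ⟨v, hv, b4⟩ := hup₂.exists_le hS hV' b3
    have b5 := (lo_of_not_up hS hV' hw₁.2).lt hS hV' b3 hv
    rw [A.f_c hw₂.lt] at b5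
    linarith
  have up' : ∀ x w, A.c j s ≤ x → x ≤ A.c p k → A.IsLowest V' w x → A.Up w V := by
    intro x w hx1 hx2 hw
    by_contra hup
    have hne : (V'.filter fun v => ¬ A.Up v V).Nonempty := ⟨w, by simp [hw.1, hup]⟩
    obtain ⟨w₁, hw₁, hmin⟩ := (V'.filter fun v => ¬ A.Up v V).exists_min_image id hne
    rw [Finset.mem_filter] at hw₁
    have hww₁ : w₁ ≤ w := hmin w (by simp [hw.1, hup])
    have hw₁j : j < w₁ := lt_of_le_of_ne (hVs' _ hw₁.1).1 fun h => hw₁.2 (h ▸ hjV)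
    obtain ⟨w₂, hw₂, hw₂j⟩ := Consecutive.exists_pred hjV' hw₁.1 hw₁j
    have hup₂ : A.Up w₂ V := by
      by_contra hn
      exact absurd (hmin w₂ (by simp [hw₂.1, hn])) (not_le.2 hw₂.lt)
    have b1 := hw.crossing_le hS hV' hw₂ hww₁
    have b2 := lowj.le_crossing hS hV' hw₂ hw₂j
    have b3 := hR (A.c w₂ w₁) b2 (by linarith)
    obtain ⟨v, hv, b4⟩ := hup₂.exists_le hS hV b3
    have b5 := (lo_of_not_up hS hV hw₁.2).lt hS hV b3 hv
    rw [← A.f_c hw₂.lt] at b5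
    linarith
  have mem' : ∀ x w, A.c j s ≤ x → x ≤ A.c p k → A.IsLowest V w x → A.IsLowest V' w x := by
    intro x w hx1 hx2 hw
    obtain ⟨v', hv'⟩ := A.exists_isLowest ⟨j, hjV'⟩ x
    obtain ⟨v, hv, c1⟩ := (up' x v' hx1 hx2 hv').exists_le hS hV (hR x hx1 hx2)
    have c2 := hw.2 v hv
    refine ⟨(up x w hx1 hx2 hw).resolve_right fun hhi => ?_, fun u hu =>
      (c2.trans c1).trans (hv'.2 u hu)⟩
    obtain ⟨u, hu, c3⟩ := hhi.exists_lt hS hV' (hR' x hx1 hx2)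
    linarith [hv'.2 u hu]
  have mem : ∀ x w, A.c j s ≤ x → x ≤ A.c p k → A.IsLowest V' w x → A.IsLowest V w x := by
    intro x w hx1 hx2 hw
    obtain ⟨v', hv'⟩ := A.exists_isLowest ⟨k, hkV⟩ x
    obtain ⟨v, hv, c1⟩ := (up x v' hx1 hx2 hv').exists_le hS hV' (hR' x hx1 hx2)
    have c2 := hw.2 v hv
    refine ⟨(up' x w hx1 hx2 hw).resolve_right fun hhi => ?_, fun u hu =>
      (c2.trans c1).trans (hv'.2 u hu)⟩
    obtain ⟨u, hu, c3⟩ := hhi.exists_lt hS hV (hR x hx1 hx2)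
    linarith [hv'.2 u hu]
  have lowj' := mem _ _ le_rfl (a2.trans a1) lowj
  have lowk' := mem' _ _ (a2.trans a1) le_rfl lowk
  constructor
  · intro hw
    rcases hjw.eq_or_lt with rfl | hjw
    · exact hjV'
    obtain ⟨d, hd, hjd⟩ := Consecutive.exists_pred lowj'.1 hw hjw
    exact (mem' _ _ (lowj'.le_crossing hS hV hd hjd) (lowk.crossing_le hS hV hd hwk)
      (isLowest_right hS hV hd)).1
  · intro hw
    rcases hwk.eq_or_lt with rfl | hwk
    · exact hkV
    obtain ⟨d, hd, hdk⟩ := Consecutive.exists_succ hw lowk'.1 hwk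
    exact (mem _ _ (lowj.le_crossing hS hV' hd hjw) (lowk'.crossing_le hS hV' hd hdk)
      (isLowest_left hS hV' hd)).1

/-- The two chains agree on [j, k], so their union is a chain from `i` to `l` containing both middle
wires. -/
theorem Spanned.trans_outer (hS : A.IsFlipRel S) {i j k l : ι} (h₁ : A.Spanned S i j k)
    (h₄ : A.Spanned S j k l) : A.Spanned S i j l ∧ A.Spanned S i k l := by
  obtain ⟨hij, hjk, hn, V, hV, hiV, hkV, hVs, hjV⟩ := h₁
  obtain ⟨-, hkl, hn', V', hV', hjV', hlV', hVs', hkV'⟩ := h₄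
  have hagree := chains_agree hS hV hV' hij hjk hkl hn hn' hiV hkV hVs hjV' hlV' hVs' hjV hkV'
  have hj := (hagree j le_rfl hjk.le).2 hjV'
  have hU := hV.union hV' hjk (fun v hv => (hVs v hv).2) (fun v hv => (hVs' v hv).1) hj hkV hagree
  have o1 := A.c_lt_of_lt hij hjk hn
  have o2 := A.c_lt_of_lt hjk hkl hn'
  have hUs : ∀ v ∈ V ∪ V', i ≤ v ∧ v ≤ l := by
    intro v hv
    rcases Finset.mem_union.1 hv with hv | hv
    · exact ⟨(hVs v hv).1, (hVs v hv).2.trans hkl.le⟩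
    · exact ⟨hij.le.trans (hVs' v hv).1, (hVs' v hv).2⟩
  exact ⟨⟨hij, hjk.trans hkl, by linarith, V ∪ V', hU, by simp [hiV], by simp [hlV'], hUs,
    Or.inl (by simp [hj])⟩, ⟨hij.trans hjk, hkl, by linarith, V ∪ V', hU, by simp [hiV],
    by simp [hlV'], hUs, Or.inl (by simp [hkV])⟩⟩

theorem spanned_of_mem (hS : A.IsFlipRel S) (hV : IsTripleChain S V) {i j k : ι}
    (hi : i ∈ V) (hj : j ∈ V) (hk : k ∈ V) (hij : i < j) (hjk : j < k) : A.Spanned S i j k := by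
  refine ⟨hij, hjk, chain_not_inverted hS hV hi hj hk hij hjk,
    (V.filter (· ≤ k)).filter (i ≤ ·), (hV.filter_le k).filter_ge i, ?_, ?_, ?_, Or.inl ?_⟩
  · simp [hi, (hij.trans hjk).le]
  · simp [hk, (hij.trans hjk).le]
  · intro v hv
    simp only [Finset.mem_filter] at hv
    exact ⟨hv.2, hv.1.2⟩
  · simp [hj, hij.le, hjk.le]

end Pseudolines

/-! ### Convex ternary relations -/

/-- The closedness condition for a set of triples, on the triples of increasing elements. -/
def IsConvexRel {ι : Type*} [LinearOrder ι] (R : ι → ι → ι → Prop) : Prop :=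
  ∀ i j k l, i < j → j < k → k < l →
    (R i j k → R i k l → R i j l) ∧ (R i j k → R j k l → R i j l ∧ R i k l) ∧
    (R i j l → R j k l → R i k l)

/-- Induction on the number of elements of `V` in [i, k]: an extra element next to `j` splits the
triple into two shorter ones, which the middle clause of convexity recombines. -/
theorem IsConvexRel.of_consecutive {ι : Type*} [LinearOrder ι] {R : ι → ι → ι → Prop}
    (hR : IsConvexRel R) {V : Finset ι} (hV : IsTripleChain R V) {i j k : ι} (hi : i ∈ V)
    (hj : j ∈ V) (hk : k ∈ V) (hij : i < j) (hjk : j < k) : R i j k := by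
  induction hn : (V.filter fun v => i ≤ v ∧ v ≤ k).card using Nat.strong_induction_on
    generalizing i j k with
  | _ n ih =>
    subst hn
    have hik := hij.trans hjk
    have shrink : ∀ i' k', i ≤ i' → k' ≤ k → (i < i' ∨ k' < k) →
        (V.filter fun v => i' ≤ v ∧ v ≤ k').card < (V.filter fun v => i ≤ v ∧ v ≤ k).card := by
      intro i' k' h1 h2 h3
      apply Finset.card_lt_card
      rw [Finset.ssubset_iff_of_subset]
      · rcases h3 with h3 | h3
        · exact ⟨i, by simp [hi, hik.le], by simp [h3]⟩
        · exact ⟨k, by simp [hk, hik.le], by simp [h3]⟩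
      · intro v hv
        simp only [Finset.mem_filter] at hv ⊢
        exact ⟨hv.1, h1.trans hv.2.1, hv.2.2.trans h2⟩
    obtain ⟨d, hd, hid⟩ := Consecutive.exists_pred hi hj hij
    obtain ⟨e, he, hek⟩ := Consecutive.exists_succ hj hk hjk
    rcases hid.eq_or_lt with rfl | hid
    · rcases hek.eq_or_lt with rfl | hek
      · exact hV _ _ _ hd he
      · exact ((hR i j e k hij he.lt hek).2.1
          (ih _ (shrink i e le_rfl hek.le (Or.inr hek)) hi hj he.2.1 hij he.lt rfl)
          (ih _ (shrink j k hij.le le_rfl (Or.inl hij)) hj he.2.1 hk he.lt hek rfl)).1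
    · exact ((hR i d j k hid hd.lt hjk).2.1
          (ih _ (shrink i j le_rfl hjk.le (Or.inr hjk)) hi hd.1 hj hid hd.lt rfl)
          (ih _ (shrink d k hid.le le_rfl (Or.inl hid)) hd.1 hj hk hd.lt hjk rfl)).2

namespace Pseudolines

variable {ι : Type*} [LinearOrder ι] (A : Pseudolines ι)

theorem spanned_isConvexRel [Finite ι] {A : Pseudolines ι} {S : ι → ι → ι → Prop}
    (hS : A.IsFlipRel S) :
    IsConvexRel (A.Spanned S) := fun _ _ _ _ _ _ _ =>
  ⟨Spanned.trans_left hS, Spanned.trans_outer hS, Spanned.trans_right hS⟩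

/-! ### Lower envelopes -/

/-- Among pseudolines that all cut off the apex of a pair `a < b` there are three consecutive ones
on the lower envelope that belong to a given coconvex relation. -/
theorem exists_envelope_triple {Y : ι → ι → ι → Prop}
    (hY : IsConvexRel fun i j k => ¬ Y i j k) {a b : ι} {U : Finset ι} (ha : a ∈ U) (hb : b ∈ U)
    (hab : a < b) (hU : ∀ p ∈ U, p ≠ a → p ≠ b → a < p ∧ p < b ∧ A.c a p < A.c p b ∧ Y a p b)
    (hne : ∃ p ∈ U, p ≠ a ∧ p ≠ b) :
    ∃ e e' e'', e ∈ U ∧ e' ∈ U ∧ e'' ∈ U ∧ e < e' ∧ e' < e'' ∧ Y e e' e'' ∧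
      A.c e e' < A.c e' e'' ∧
      ∀ p ∈ U, A.f e' (A.c e e') ≤ A.f p (A.c e e') ∧ A.f e' (A.c e' e'') ≤ A.f p (A.c e' e'') := by
  classical
  have hmem : ∀ p ∈ U, a ≤ p ∧ p ≤ b := by
    intro p hp
    by_cases h1 : p = a
    · subst h1; exact ⟨le_rfl, hab.le⟩
    by_cases h2 : p = b
    · subst h2; exact ⟨hab.le, le_rfl⟩
    exact ⟨(hU p hp h1 h2).1.le, (hU p hp h1 h2).2.1.le⟩
  -- `E` is the set of pseudolines on the lower envelope. The wire `w` lowest at the crossing of a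
  -- and b lies in it, strictly between `a` and `b`. If no consecutive triple of `E` were in `Y`,
  -- coconvexity would exclude (a, w, b) as well.
  let E : Finset ι := U.filter fun e => ∃ x, ∀ p ∈ U, A.f e x ≤ A.f p x
  have memE : ∀ e, e ∈ E ↔ e ∈ U ∧ ∃ x, ∀ p ∈ U, A.f e x ≤ A.f p x := fun e => by simp [E]
  have haE : a ∈ E := by
    obtain ⟨p, hp, hmin⟩ := (U.erase a).exists_min_image (fun p => A.c a p)
      ⟨b, by simp [hb, hab.ne']⟩
    refine (memE a).2 ⟨ha, A.c a p, fun q hq => ?_⟩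
    by_cases hqa : q = a
    · rw [hqa]
    · exact (A.le_iff (lt_of_le_of_ne (hmem q hq).1 (Ne.symm hqa)) _).2 (hmin q (by simp [hq, hqa]))
  have hbE : b ∈ E := by
    obtain ⟨p, hp, hmax⟩ := (U.erase b).exists_max_image (fun p => A.c p b)
      ⟨a, by simp [ha, hab.ne]⟩
    refine (memE b).2 ⟨hb, A.c p b, fun q hq => ?_⟩
    by_cases hqa : q = b
    · rw [hqa]
    · exact (A.ge_iff (lt_of_le_of_ne (hmem q hq).2 hqa) _).2 (hmax q (by simp [hq, hqa]))
  obtain ⟨w, hwU, hw⟩ := U.exists_min_image (fun v => A.f v (A.c a b)) ⟨a, ha⟩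
  have hwE : w ∈ E := (memE w).2 ⟨hwU, _, hw⟩
  obtain ⟨p, hpU, hpa, hpb⟩ := hne
  obtain ⟨hap, hpb', hpn, -⟩ := hU p hpU hpa hpb
  have hlt : A.f p (A.c a b) < A.f a (A.c a b) :=
    (A.gt_iff hap _).2 (A.c_lt_of_lt hap hpb' hpn).1
  have hwp := hw p hpU
  have hwa : w ≠ a := by rintro rfl; linarith
  have hwb : w ≠ b := by rintro rfl; rw [← A.f_c hab] at hwp; linarith
  obtain ⟨haw, hwb', -, hwY⟩ := hU w hwU hwa hwb
  have hex : ∃ e e' e'', Consecutive E e e' ∧ Consecutive E e' e'' ∧ Y e e' e'' := by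
    by_contra hcon
    push Not at hcon
    exact hY.of_consecutive (V := E) (fun e e' e'' h h' => hcon e e' e'' h h') haE hwE hbE haw hwb'
      hwY
  obtain ⟨e, e', e'', he, he', heY⟩ := hex
  have env : ∀ u v, Consecutive E u v → ∀ p ∈ U, A.f u (A.c u v) ≤ A.f p (A.c u v) := by
    intro u v huv
    obtain ⟨m, hmU, hm⟩ := U.exists_min_image (fun q => A.f q (A.c u v)) ⟨a, ha⟩
    suffices h : A.f u (A.c u v) ≤ A.f m (A.c u v) from fun p hp => h.trans (hm p hp)
    have hmE : m ∈ E := (memE m).2 ⟨hmU, _, hm⟩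
    obtain ⟨huU, y, hy⟩ := (memE u).1 huv.1
    obtain ⟨hvU, z, hz⟩ := (memE v).1 huv.2.1
    have h1 := (A.le_iff huv.lt _).1 (hy v hvU)
    have h2 := (A.ge_iff huv.lt _).1 (hz u huU)
    rcases huv.2.2.2 m hmE with h | h
    · rcases h.eq_or_lt with rfl | h
      · exact le_rfl
      · have h3 := (A.ge_iff h _).1 (hy m hmU)
        exact (A.ge_iff h _).2 (h3.trans h1)
    · rw [A.f_c huv.lt]
      rcases h.eq_or_lt with rfl | h
      · exact le_rfl
      · have h3 := (A.le_iff h _).1 (hz m hmU)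
        exact (A.le_iff h _).2 (h2.trans h3)
  have hE := fun x (hx : x ∈ E) => ((memE x).1 hx).1
  obtain ⟨he'U, x, hx⟩ := (memE e').1 he.2.1
  refine ⟨e, e', e'', hE _ he.1, he'U, hE _ he'.2.1, he.lt, he'.lt, heY, ?_, fun p hp => ⟨?_, ?_⟩⟩
  · have h1 := (A.ge_iff he.lt _).1 (hx e (hE _ he.1))
    have h2 := (A.le_iff he'.lt _).1 (hx e'' (hE _ he'.2.1))
    exact lt_of_le_of_ne (h1.trans h2) (A.c_ne he.lt he'.lt)
  · rw [← A.f_c he.lt]; exact env _ _ he p hp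
  · exact env _ _ he' p hp

/-! ### Triangles and the pseudolines that cut them -/

/-- The pseudolines that cut off the apex of the triangle `i < j < k`. -/
def cutters (i j k : ι) : Set ι := {p | A.Above p i j ∧ A.Above p j k ∧ ¬ A.Above p i k}

/-- The pseudolines below the floor of the triangle `i < j < k`. -/
def belowFloor (i j k : ι) : Set ι :=
  {q | A.f q (A.c i j) < A.f j (A.c i j) ∧ A.f q (A.c j k) < A.f j (A.c j k)}

/-- No pseudoline crosses the floor of the triangle `i < j < k`. -/
def FloorUncut (i j k : ι) : Prop :=
  ∀ q, q ≠ i → q ≠ j → q ≠ k → (A.Above q i j ↔ A.Above q j k)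

/-- A triangle `i < j < k` which is not inverted and which no pseudoline enters. -/
def IsFlip (i j k : ι) : Prop :=
  i < j ∧ j < k ∧ A.c i j < A.c j k ∧ ∀ q, q ≠ i → q ≠ j → q ≠ k →
    (A.Above q i j ↔ A.Above q j k) ∧ (A.Above q i j ↔ A.Above q i k)

variable {A}

theorem cutters_spec {i j k p : ι} (hij : i < j) (hjk : j < k) (hn : A.c i j < A.c j k)
    (hp : p ∈ A.cutters i j k) :
    i < p ∧ p < k ∧ A.c i j < A.c i p ∧ A.c i p < A.c i k ∧ A.c i k < A.c p k ∧
      A.c p k < A.c j k ∧ A.f j (A.c i p) < A.f p (A.c i p) ∧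
      A.f j (A.c p k) < A.f p (A.c p k) := by
  obtain ⟨h1, h2, h3⟩ := hp
  have hik := hij.trans hjk
  have o := A.c_lt_of_lt hij hjk hn
  have hpi : p ≠ i := by rintro rfl; exact lt_irrefl _ h1
  have hpk : p ≠ k := by
    rintro rfl
    rw [Above, A.f_c hjk] at h2; exact lt_irrefl _ h2
  have h4 := A.lt_of_not_above hik hpi hpk h3
  have h2' := h2
  have h1' := h1
  rw [Above] at h1 h2
  rw [A.f_c hjk] at h2
  have h5 := h4
  rw [A.f_c hik] at h5
  rw [Above, A.f_c hij] at h1'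
  rw [Above] at h2'
  have hip : i < p := by
    rcases hpi.lt_or_gt with h | h
    · rw [A.gt_iff h] at h1
      rw [A.lt_iff h] at h4
      linarith
    · exact h
  have hpk' : p < k := by
    rcases hpk.lt_or_gt with h | h
    · exact h
    · rw [A.lt_iff h] at h2
      rw [A.gt_iff h] at h5
      linarith
  rw [A.lt_iff hip] at h1
  rw [A.gt_iff hip] at h4
  rw [A.gt_iff hpk'] at h2
  rw [A.lt_iff hpk'] at h5
  exact ⟨hip, hpk', h1, h4, h5, h2, A.between h1.le (by linarith) h1' h2',
    A.between (by linarith) h2.le h1' h2'⟩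

/-- If `p` < `j`, passing above the crossing of i and j makes (i, p, j) inverted, hence in `Y`;
closedness with (i, j, k) gives the claim. The case `j` < `p` is symmetric, with (j, p, k). -/
theorem cutters_mem {Y : ι → ι → ι → Prop} (hY : IsConvexRel Y)
    (hXY : ∀ i j k, i < j → j < k → A.c j k < A.c i j → Y i j k) {i j k p : ι} (hij : i < j)
    (hjk : j < k) (hn : A.c i j < A.c j k) (hYijk : Y i j k) (hp : p ∈ A.cutters i j k) :
    Y i p k := by
  obtain ⟨hip, hpk, -⟩ := cutters_spec hij hjk hn hp
  obtain ⟨h1, h2, h3⟩ := hp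
  have hpj : p ≠ j := by
    rintro rfl
    rw [Above, A.f_c hij] at h1; exact lt_irrefl _ h1
  rcases hpj.lt_or_gt with h | h
  · exact (hY i p j k hip h hjk).1 (hXY _ _ _ hip h ((A.above_iff_mid hip h).1 h1)) hYijk
  · exact (hY i j p k hij h hpk).2.2 hYijk (hXY _ _ _ h hpk ((A.above_iff_mid h hpk).1 h2))

/-- The new triangle is a consecutive triple on the lower envelope of `i`, `k` and the cutters. The
dichotomy `hq` keeps every other wire either below its floor or above all its vertices, so its
cutters are among the old ones. The floor wire `e'` is an old cutter but not a new one, so the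
inclusion is strict. -/
theorem exists_smaller_triangle [Finite ι] {Y : ι → ι → ι → Prop} (hY : IsConvexRel Y)
    (hY' : IsConvexRel fun i j k => ¬ Y i j k)
    (hXY : ∀ i j k, i < j → j < k → A.c j k < A.c i j → Y i j k) {i j k : ι} (hij : i < j)
    (hjk : j < k) (hn : A.c i j < A.c j k) (hYijk : Y i j k) (hne : (A.cutters i j k).Nonempty)
    (hq : ∀ q, q ∉ A.cutters i j k → q ≠ i → q ≠ j → q ≠ k →
      (∀ p ∈ A.cutters i j k, A.f q (A.c i p) < A.f p (A.c i p) ∧ A.f q (A.c p k) < A.f p (A.c p k))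
      ∨ (A.Above q i j ∧ A.Above q j k ∧ A.Above q i k)) :
    ∃ e e' e'', e < e' ∧ e' < e'' ∧ A.c e e' < A.c e' e'' ∧ Y e e' e'' ∧ A.FloorUncut e e' e'' ∧
      A.cutters e e' e'' ⊂ A.cutters i j k ∧
      ∀ q, (∀ p ∈ A.cutters i j k,
        A.f q (A.c i p) < A.f p (A.c i p) ∧ A.f q (A.c p k) < A.f p (A.c p k)) →
          q ∈ A.belowFloor e e' e'' := by
  classical
  have hik := hij.trans hjk
  let K : Finset ι := (Set.toFinite (A.cutters i j k)).toFinset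
  have memK : ∀ p, p ∈ K ↔ p ∈ A.cutters i j k := fun p => Set.Finite.mem_toFinset _
  let U : Finset ι := insert i (insert k K)
  have memU : ∀ p, p ∈ U ↔ p = i ∨ p = k ∨ p ∈ A.cutters i j k := fun p => by
    simp only [U, Finset.mem_insert, memK]
  have spec := fun p (hp : p ∈ A.cutters i j k) => cutters_spec hij hjk hn hp
  obtain ⟨p₀, hp₀⟩ := hne
  obtain ⟨e, e', e'', heU, he'U, he''U, hee', he'e'', heY, hen, hlow⟩ :=
    A.exists_envelope_triple hY' (a := i) (b := k) (U := U) ((memU i).2 (Or.inl rfl))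
      ((memU k).2 (Or.inr (Or.inl rfl))) hik
      (fun p hp hpi hpk => by
        have hp' := (((memU p).1 hp).resolve_left hpi).resolve_left hpk
        have := spec p hp'
        exact ⟨this.1, this.2.1, by linarith [this.2.2.2.1, this.2.2.2.2.1],
          cutters_mem hY hXY hij hjk hn hYijk hp'⟩)
      ⟨p₀, (memU _).2 (Or.inr (Or.inr hp₀)), (spec p₀ hp₀).1.ne', (spec p₀ hp₀).2.1.ne⟩
  have hlimits : ∀ p ∈ U, i ≤ p ∧ p ≤ k := by
    intro p hp
    rcases (memU p).1 hp with rfl | rfl | hp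
    · exact ⟨le_rfl, hik.le⟩
    · exact ⟨hik.le, le_rfl⟩
    · exact ⟨(spec p hp).1.le, (spec p hp).2.1.le⟩
  have hie' : i < e' := (hlimits e heU).1.trans_lt hee'
  have he'k : e' < k := he'e''.trans_le (hlimits e'' he''U).2
  have he' : e' ∈ A.cutters i j k :=
    (((memU e').1 he'U).resolve_left hie'.ne').resolve_left he'k.ne
  have he : e = i ∨ e ∈ A.cutters i j k :=
    ((memU e).1 heU).imp_right fun h => h.resolve_left (hee'.trans he'k).ne
  have he'' : e'' = k ∨ e'' ∈ A.cutters i j k :=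
    ((memU e'').1 he''U).resolve_left (hie'.trans he'e'').ne'
  have hiU : i ∈ U := (memU i).2 (Or.inl rfl)
  have hkU : k ∈ U := (memU k).2 (Or.inr (Or.inl rfl))
  have o := A.c_lt_of_lt hee' he'e'' hen
  have b1 := (A.ge_iff hie' _).1 (hlow i hiU).1
  have b2 := (A.le_iff he'k _).1 (hlow k hkU).2
  have low : ∀ q, (∀ p ∈ A.cutters i j k,
        A.f q (A.c i p) < A.f p (A.c i p) ∧ A.f q (A.c p k) < A.f p (A.c p k)) →
          q ∈ A.belowFloor e e' e'' := by
    intro q hq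
    obtain ⟨h1, h2⟩ := hq e' he'
    exact ⟨A.between b1 (by linarith) h1 h2, A.between (by linarith) b2 h1 h2⟩
  have lowj := low j fun p hp => (spec p hp).2.2.2.2.2.2
  have not_above : ∀ q ∈ A.belowFloor e e' e'', ¬ A.Above q e e' ∧ ¬ A.Above q e' e'' := by
    intro q hq
    refine ⟨fun h => ?_, fun h => lt_asymm h hq.2⟩
    rw [Above, A.f_c hee'] at h
    exact lt_asymm h hq.1
  have high : ∀ q, (A.Above q i j ∧ A.Above q j k ∧ A.Above q i k) → ∀ g ∈ A.cutters i j k,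
      A.f g (A.c i g) < A.f q (A.c i g) ∧ A.f g (A.c g k) < A.f q (A.c g k) := by
    rintro q ⟨h1, h2, h3⟩ g hg
    obtain ⟨g1, g2, g3, g4, g5, g6, -⟩ := spec g hg
    constructor
    · rw [← A.f_c g1]
      exact A.between g3.le g4.le h1 h3
    · rw [A.f_c g2]
      rw [Above, A.f_c hik] at h3
      rw [Above, A.f_c hjk] at h2
      exact A.between g5.le g6.le h3 h2
  refine ⟨e, e', e'', hee', he'e'', hen, heY, ?_, ?_, low⟩
  · intro q hqe hqe' hqe''
    by_cases hqU : q ∈ U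
    · obtain ⟨h1, h2⟩ := hlow q hqU
      have h3 : A.Above q e e' := by
        by_contra h
        have := A.lt_of_not_above hee' hqe hqe' h
        rw [A.f_c hee'] at this
        linarith
      have h4 : A.Above q e' e'' := by
        by_contra h
        have := A.lt_of_not_above he'e'' hqe' hqe'' h
        linarith
      exact iff_of_true h3 h4
    · by_cases hqj : q = j
      · have := not_above q (hqj ▸ lowj)
        exact iff_of_false this.1 this.2
      rw [memU, not_or, not_or] at hqU
      rcases hq q hqU.2.2 hqU.1 hqj hqU.2.1 with h | h
      · have := not_above q (low q h)
        exact iff_of_false this.1 this.2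
      · obtain ⟨h1, h2⟩ := high q h e' he'
        refine iff_of_true ?_ (A.between (by linarith) b2 h1 h2)
        rw [Above, A.f_c hee']
        exact A.between b1 (by linarith) h1 h2
  · rw [Set.ssubset_iff_of_subset]
    · refine ⟨e', he', fun h => ?_⟩
      have := h.2.1
      exact lt_irrefl _ this
    · intro p hp
      obtain ⟨h1, h2, h3⟩ := hp
      have c1 : e ≠ i → A.c i e ≤ A.c e e' := fun hne => by
        have hlt := lt_of_le_of_ne (hlimits e heU).1 (Ne.symm hne)
        have := (hlow i hiU).1
        rwa [← A.f_c hee', A.ge_iff hlt] at this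
      have c2 : e'' ≠ k → A.c e' e'' ≤ A.c e'' k := fun hne => by
        have hlt := lt_of_le_of_ne (hlimits e'' he''U).2 hne
        have := (hlow k hkU).2
        rwa [A.f_c he'e'', A.le_iff hlt] at this
      by_contra hcut
      by_cases hpi : p = i
      · subst hpi
        have hne : e ≠ p := by rintro rfl; exact lt_irrefl _ h1
        have hlt := lt_of_le_of_ne (hlimits e heU).1 hne.symm
        exact h3 ((A.gt_iff hlt _).2 ((c1 hne).trans_lt o.1))
      by_cases hpk : p = k
      · subst hpk
        have hne : e'' ≠ p := by
          rintro rfl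
          rw [Above, A.f_c he'e''] at h2; exact lt_irrefl _ h2
        have hlt := lt_of_le_of_ne (hlimits e'' he''U).2 hne
        apply h3
        rw [Above, A.f_c (hee'.trans he'e'')]
        exact (A.lt_iff hlt _).2 (o.2.trans_le (c2 hne))
      by_cases hpj : p = j
      · subst hpj
        exact (not_above p lowj).1 h1
      rcases hq p hcut hpi hpj hpk with h | h
      · exact (not_above p (low p h)).1 h1
      apply h3
      have hee'' := hee'.trans he'e''
      rcases he with rfl | he
      · rcases he'' with rfl | he''
        · exact h.2.2
        · rw [Above, A.f_c hee'']
          exact (high p h e'' he'').1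
      · obtain ⟨h4, h5⟩ := high p h e he
        obtain ⟨g1, g2, -⟩ := spec e he
        refine A.between ((c1 g1.ne').trans o.1.le) ?_ h4 h5
        by_cases hk : e'' = k
        · rw [hk]
        · have hlt := lt_of_le_of_ne (hlimits e'' he''U).2 hk
          rw [← A.le_iff g2, A.f_c hee'', A.le_iff hlt]
          exact (o.2.trans_le (c2 hk)).le

theorem not_above_of_belowFloor {i j k q : ι} (hij : i < j) (hjk : j < k) (hn : A.c i j < A.c j k)
    (hq : q ∈ A.belowFloor i j k) : ¬ A.Above q i j ∧ ¬ A.Above q j k ∧ ¬ A.Above q i k := by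
  have o := A.c_lt_of_lt hij hjk hn
  refine ⟨fun h => ?_, fun h => lt_asymm h hq.2, fun h => ?_⟩
  · rw [Above, A.f_c hij] at h
    exact lt_asymm h hq.1
  · have h1 := A.between o.1.le o.2.le hq.1 hq.2
    have h2 := (A.gt_iff hij _).2 o.1
    exact lt_asymm h (h1.trans h2)

theorem mem_belowFloor_of_not_above {i j k q : ι} (hij : i < j) (hjk : j < k) (hqi : q ≠ i)
    (hqj : q ≠ j) (hqk : q ≠ k) (h₁ : ¬ A.Above q i j) (h₂ : ¬ A.Above q j k) :
    q ∈ A.belowFloor i j k := by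
  refine ⟨?_, A.lt_of_not_above hjk hqj hqk h₂⟩
  rw [← A.f_c hij]
  exact A.lt_of_not_above hij hqi hqj h₁

/-- Strong induction on the number of cutters. With an uncut floor and no cutters nothing enters the
triangle; otherwise `exists_smaller_triangle` applies, and no wire is lost from below the floor. -/
theorem exists_flip [Finite ι] {Y : ι → ι → ι → Prop} (hY : IsConvexRel Y)
    (hY' : IsConvexRel fun i j k => ¬ Y i j k)
    (hXY : ∀ i j k, i < j → j < k → A.c j k < A.c i j → Y i j k) {i j k : ι} (hij : i < j)
    (hjk : j < k) (hn : A.c i j < A.c j k) (hYijk : Y i j k) (hfloor : A.FloorUncut i j k) :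
    ∃ a b d, A.IsFlip a b d ∧ Y a b d ∧ A.belowFloor i j k ⊆ A.belowFloor a b d := by
  induction hm : (A.cutters i j k).ncard using Nat.strong_induction_on generalizing i j k with
  | _ m ih =>
    subst hm
    rcases (A.cutters i j k).eq_empty_or_nonempty with hempty | hne
    · refine ⟨i, j, k, ⟨hij, hjk, hn, fun q hqi hqj hqk => ⟨hfloor q hqi hqj hqk, ?_⟩⟩, hYijk,
        subset_rfl⟩
      by_cases h : A.Above q i j
      · refine iff_of_true h ?_
        by_contra hcon
        have : q ∈ A.cutters i j k := ⟨h, (hfloor q hqi hqj hqk).1 h, hcon⟩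
        rw [hempty] at this
        exact this
      · exact iff_of_false h (not_above_of_belowFloor hij hjk hn
          (mem_belowFloor_of_not_above hij hjk hqi hqj hqk h
            (fun h' => h ((hfloor q hqi hqj hqk).2 h')))).2.2
    · have below : ∀ q ∈ A.belowFloor i j k, ∀ p ∈ A.cutters i j k,
          A.f q (A.c i p) < A.f p (A.c i p) ∧ A.f q (A.c p k) < A.f p (A.c p k) := by
        intro q hq p hp
        obtain ⟨-, -, h1, h2, h3, h4, h5, h6⟩ := cutters_spec hij hjk hn hp
        exact ⟨(A.between h1.le (by linarith) hq.1 hq.2).trans h5,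
          (A.between (by linarith) h4.le hq.1 hq.2).trans h6⟩
      obtain ⟨e, e', e'', h1, h2, h3, h4, h5, h6, h7⟩ :=
        exists_smaller_triangle hY hY' hXY hij hjk hn hYijk hne (by
          intro q hqc hqi hqj hqk
          by_cases h : A.Above q i j
          · have h' := (hfloor q hqi hqj hqk).1 h
            refine Or.inr ⟨h, h', ?_⟩
            by_contra hcon
            exact hqc ⟨h, h', hcon⟩
          · exact Or.inl (below q (mem_belowFloor_of_not_above hij hjk hqi hqj hqk h
              (fun h' => h ((hfloor q hqi hqj hqk).2 h')))))
      obtain ⟨a, b, d, g1, g2, g3⟩ := ih _ (Set.ncard_lt_ncard h6) h1 h2 h3 h4 h5 rfl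
      exact ⟨a, b, d, g1, g2, fun q hq => g3 (h7 q (below q hq))⟩

/-! ### Chains through a flip of maximum height -/

theorem InRange.between {V : Finset ι} {x y z : ℝ} (hx : A.InRange V x) (hy : A.InRange V y)
    (h₁ : x ≤ z) (h₂ : z ≤ y) : A.InRange V z := by
  obtain ⟨a, b, -, -, hab, -, h3, -⟩ := hx
  obtain ⟨-, -, a', b', -, hab', -, h4⟩ := hy
  exact ⟨a, b, a', b', hab, hab', h3.trans h₁, h₂.trans h4⟩

variable [Finite ι] {S : ι → ι → ι → Prop} {V : Finset ι}

/-- A chain element strictly between two of the three would, by non-inversion within the chain, pass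
above one end of the floor and below the other. -/
theorem consecutive_of_flip (hS : A.IsFlipRel S) (hV : IsTripleChain S V) {u v w : ι}
    (hu : u ∈ V) (hv : v ∈ V) (hw : w ∈ V) (h : S u v w) :
    Consecutive V u v ∧ Consecutive V v w := by
  obtain ⟨huv, hvw, -, hq⟩ := hS _ _ _ h
  refine ⟨⟨hu, hv, huv, fun d hd => ?_⟩, ⟨hv, hw, hvw, fun d hd => ?_⟩⟩
  · by_contra hcon
    rw [not_or, not_le, not_le] at hcon
    have h1 := chain_not_inverted hS hV hu hd hv hcon.1 hcon.2
    have h2 := chain_not_inverted hS hV hd hv hw hcon.2 hvw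
    have h3 := (hq d hcon.1.ne' hcon.2.ne (hcon.2.trans hvw).ne).2 ((A.above_iff_left hcon.2).2 h2)
    rw [A.above_iff_mid hcon.1 hcon.2] at h3
    linarith
  · by_contra hcon
    rw [not_or, not_le, not_le] at hcon
    have h1 := chain_not_inverted hS hV hv hd hw hcon.1 hcon.2
    have h2 := chain_not_inverted hS hV hu hv hd huv hcon.1
    have h3 := (hq d (huv.trans hcon.1).ne' hcon.1.ne' hcon.2.ne).1
      ((A.above_iff_right huv hcon.1).2 h2)
    rw [A.above_iff_mid hcon.1 hcon.2] at h3
    linarith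

/-- A pseudoline outside a chain that contains a flip of maximum height does not separate the
crossings of the chain. -/
theorem above_of_hi (hS : A.IsFlipRel S) (hV : IsTripleChain S V) {Y : ι → ι → ι → Prop}
    (hY : IsConvexRel Y) (hY' : IsConvexRel fun i j k => ¬ Y i j k)
    (hXY : ∀ i j k, i < j → j < k → A.c j k < A.c i j → Y i j k)
    (hSY : ∀ i j k, S i j k → Y i j k) {u v w : ι} (hu : u ∈ V) (hv : v ∈ V) (hw : w ∈ V)
    (huvw : S u v w)
    (hmax : ∀ a b d, A.IsFlip a b d → Y a b d →
      (A.belowFloor a b d).ncard ≤ (A.belowFloor u v w).ncard)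
    {q a b : ι} (hqV : q ∉ V) (hq : A.Hi q V) (ha : a ∈ V) (hb : b ∈ V) (hab : a < b) :
    A.Above q a b := by
  induction hm : (V.filter fun x => a ≤ x ∧ x ≤ b).card using Nat.strong_induction_on
    generalizing a b q with
  | _ m ih =>
  subst hm
  by_contra hnot
  -- For a shortest interval [a, b] that fails, `d` is the floor of a triangle whose apex `q` cuts
  -- off. By minimality, cutters pass above every crossing of `a` or `b` with a chain element
  -- strictly between them.
  obtain ⟨d, hd, hdb⟩ := Consecutive.exists_succ ha hb hab
  rcases hdb.eq_or_lt with rfl | hdb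
  · exact hnot (hq _ _ hd)
  have had := hd.lt
  have hdV := hd.2.1
  have NI := fun {i j k : ι} (hi : i ∈ V) (hj : j ∈ V) (hk : k ∈ V) =>
    A.chain_not_inverted hS hV hi hj hk
  have ih' : ∀ t ∈ V, a < t → t < b → ∀ q, q ∉ V → A.Hi q V → A.Above q a t ∧ A.Above q t b := by
    intro t ht hat htb q hqV hq
    constructor
    · refine ih _ ?_ hqV hq ha ht hat rfl
      apply Finset.card_lt_card
      rw [Finset.ssubset_iff_of_subset]
      · exact ⟨b, by simp [hb, hab.le], by simp [htb]⟩
      · intro x hx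
        simp only [Finset.mem_filter] at hx ⊢
        exact ⟨hx.1, hx.2.1, hx.2.2.trans htb.le⟩
    · refine ih _ ?_ hqV hq ht hb htb rfl
      apply Finset.card_lt_card
      rw [Finset.ssubset_iff_of_subset]
      · exact ⟨a, by simp [ha, hab.le], by simp [hat]⟩
      · intro x hx
        simp only [Finset.mem_filter] at hx ⊢
        exact ⟨hx.1, hat.le.trans hx.2.1, hx.2.2⟩
  have hn := NI ha hdV hb had hdb
  have hne : (A.cutters a d b).Nonempty :=
    ⟨q, (ih' d hdV had hdb q hqV hq).1, (ih' d hdV had hdb q hqV hq).2, hnot⟩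
  have cutV : ∀ p ∈ A.cutters a d b, p ∉ V ∧ A.Hi p V := by
    intro p hp
    obtain ⟨h1, h2, -⟩ := cutters_spec had hdb hn hp
    have hpV : p ∉ V := by
      intro hpV
      obtain ⟨g1, g2, -⟩ := hp
      rcases lt_trichotomy p d with h | rfl | h
      · rw [A.above_iff_mid h1 h] at g1
        exact lt_asymm g1 (NI ha hpV hdV h1 h)
      · exact lt_irrefl _ g2
      · rw [A.above_iff_mid h h2] at g2
        exact lt_asymm g2 (NI hdV hpV hb h h2)
    exact ⟨hpV, A.hi_of_above hS hV hpV (A.inRange_crossing hS hV ha hdV had) ha (le_of_lt hp.1)⟩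
  have below : ∀ q, A.Lo q V → ∀ p ∈ A.cutters a d b,
      A.f q (A.c a p) < A.f p (A.c a p) ∧ A.f q (A.c p b) < A.f p (A.c p b) := by
    intro q hq p hp
    obtain ⟨h1, h2, h3, h4, h5, h6, -⟩ := cutters_spec had hdb hn hp
    have r1 := A.inRange_crossing hS hV ha hdV had
    have r2 := A.inRange_crossing hS hV ha hb hab
    have r3 := A.inRange_crossing hS hV hdV hb hdb
    obtain ⟨w₁, hw₁, g1⟩ := (cutV p hp).2.exists_lt hS hV (r1.between r2 h3.le h4.le)
    obtain ⟨w₂, hw₂, g2⟩ := (cutV p hp).2.exists_lt hS hV (r2.between r3 h5.le h6.le)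
    exact ⟨(hq.lt hS hV (r1.between r2 h3.le h4.le) hw₁).trans g1,
      (hq.lt hS hV (r2.between r3 h5.le h6.le) hw₂).trans g2⟩
  obtain ⟨e, e', e'', h1, h2, h3, h4, h5, -, h7⟩ :=
    exists_smaller_triangle hY hY' hXY had hdb hn
      (hY.of_consecutive (fun i j k h h' => hSY _ _ _ (hV _ _ _ h h')) ha hdV hb had hdb) hne (by
      intro q hqc hqa hqd hqb
      by_cases hqV : q ∈ V
      · rcases hqa.lt_or_gt with h | h
        · exact Or.inr ⟨(A.above_iff_left h).2 (NI hqV ha hdV h had),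
            (A.above_iff_left (h.trans had)).2 (NI hqV hdV hb (h.trans had) hdb),
            (A.above_iff_left h).2 (NI hqV ha hb h hab)⟩
        rcases hqb.lt_or_gt with h' | h'
        · refine Or.inl fun p hp => ?_
          obtain ⟨g1, g2⟩ := cutV p hp
          obtain ⟨g3, g4⟩ := ih' q hqV h h' p g1 g2
          exact (cutters_spec h h' (NI ha hqV hb h h') ⟨g3, g4, hp.2.2⟩).2.2.2.2.2.2
        · exact Or.inr ⟨(A.above_iff_right had (hdb.trans h')).2 (NI ha hdV hqV had (hdb.trans h')),
            (A.above_iff_right hdb h').2 (NI hdV hb hqV hdb h'),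
            (A.above_iff_right hab h').2 (NI ha hb hqV hab h')⟩
      · rcases hi_or_lo hS hV hqV with h | h
        · obtain ⟨g1, g2⟩ := ih' d hdV had hdb q hqV h
          refine Or.inr ⟨g1, g2, ?_⟩
          by_contra hcon
          exact hqc ⟨g1, g2, hcon⟩
        · exact Or.inl (below q h))
  obtain ⟨x, y, z, g1, g2, g3⟩ := exists_flip hY hY' hXY h1 h2 h3 h4 h5
  have hmax' := hmax x y z g1 g2
  obtain ⟨huv, hvw'⟩ := consecutive_of_flip hS hV hu hv hw huvw
  have hdnot : d ∉ A.belowFloor u v w := fun h => by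
    have := le_at_consecutive hS hV huv hdV
    rw [A.f_c huv.lt] at this
    exact absurd h.1 (not_lt.2 this)
  -- Wires below the floor of the maximal flip run below the whole chain, hence below every cutter
  -- and below the new floor. The chain element `d` is an additional wire there, so the height
  -- strictly increases.
  have hsub : insert d (A.belowFloor u v w) ⊆ A.belowFloor x y z := by
    intro t ht
    rcases Set.mem_insert_iff.1 ht with rfl | ht
    · exact g3 (h7 t fun p hp => (cutters_spec had hdb hn hp).2.2.2.2.2.2)
    · refine g3 (h7 t (below t ?_))
      have htV : t ∉ V := fun h => by
        have := le_at_consecutive hS hV huv h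
        rw [A.f_c huv.lt] at this
        exact absurd ht.1 (not_lt.2 this)
      refine (hi_or_lo hS hV htV).resolve_left fun h => ?_
      have h1 := h _ _ huv
      rw [A.f_c huv.lt] at h1
      exact lt_asymm h1 ht.1
  have := Set.ncard_le_ncard hsub
  rw [Set.ncard_insert_of_notMem hdnot] at this
  omega

end Pseudolines

/-! ### Maximal chains and closedness of inversions -/

namespace Pseudolines

variable {ι : Type*} [LinearOrder ι] {A : Pseudolines ι} {S : ι → ι → ι → Prop} {V : Finset ι}

/-- For `y` < `z`, the uncut floor of (a, b, y) forces (b, y, z) to be non-inverted, while the uncut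
floor of (a, b, z) forces it to be inverted. -/
theorem IsFlipRel.right_unique [Finite ι] (hS : A.IsFlipRel S) {a b y z : ι} (hy : S a b y)
    (hz : S a b z) : y = z := by
  by_contra hne
  wlog h : y < z generalizing y z
  · exact this hz hy (Ne.symm hne) (lt_of_le_of_ne (not_lt.1 h) (Ne.symm hne))
  obtain ⟨hab, hby, h1, h2⟩ := hS _ _ _ hy
  obtain ⟨-, hbz, h3, h4⟩ := hS _ _ _ hz
  have h5 := (h2 z (hab.trans hbz).ne' hbz.ne' h.ne').1 ((A.above_iff_right hab hbz).2 h3)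
  have h6 := (h4 y (hab.trans hby).ne' hby.ne' h.ne).1 ((A.above_iff_right hab hby).2 h1)
  rw [A.above_iff_right hby h] at h5
  rw [A.above_iff_mid hby h] at h6
  exact lt_asymm h5 h6

theorem IsFlipRel.left_unique [Finite ι] (hS : A.IsFlipRel S) {a b y z : ι} (hy : S y a b)
    (hz : S z a b) : y = z := by
  by_contra hne
  wlog h : y < z generalizing y z
  · exact this hz hy (Ne.symm hne) (lt_of_le_of_ne (not_lt.1 h) (Ne.symm hne))
  obtain ⟨hya, hab, h1, h2⟩ := hS _ _ _ hy
  obtain ⟨hza, -, h3, h4⟩ := hS _ _ _ hz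
  have h5 := (h2 z h.ne' hza.ne (hza.trans hab).ne).2 ((A.above_iff_left hza).2 h3)
  have h6 := (h4 y h.ne hya.ne (hya.trans hab).ne).2 ((A.above_iff_left hya).2 h1)
  rw [A.above_iff_mid h hza] at h5
  rw [A.above_iff_left h] at h6
  exact lt_asymm h5 h6

/-- At the first index `t` beyond `c` where the chains differ, the two preceding elements are common
to both. A flip is determined by its first two wires, so the chains can differ only if `V` has
already ended; then `t` could be appended to `V`. -/
theorem mem_of_maximal_right [Finite ι] (hS : A.IsFlipRel S) (hV : IsTripleChain S V)
    (hmax : ∀ y, IsTripleChain S (insert y V) → y ∈ V) {V' : Finset ι} (hV' : IsTripleChain S V')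
    {b c y : ι} (hbc : b < c) (hb : b ∈ V) (hc : c ∈ V)
    (hagree : ∀ w, b ≤ w → w ≤ c → (w ∈ V ↔ w ∈ V')) (hy : y ∈ V') (hcy : c < y) : y ∈ V := by
  by_contra hyV
  have hne : ((V ∪ V').filter fun t => c < t ∧ ¬ (t ∈ V ↔ t ∈ V')).Nonempty :=
    ⟨y, by simp [hy, hcy, hyV]⟩
  obtain ⟨t, ht, hmin⟩ := Finset.exists_min_image _ id hne
  simp only [Finset.mem_filter] at ht
  obtain ⟨-, hct, htne⟩ := ht
  have agree : ∀ w, b ≤ w → w < t → (w ∈ V ↔ w ∈ V') := by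
    intro w hbw hwt
    rcases le_or_gt w c with h | h
    · exact hagree w hbw h
    · by_contra hcon
      have hmem : w ∈ V ∪ V' := by
        rw [Finset.mem_union]; tauto
      exact absurd (hmin w (by simp only [Finset.mem_filter]; exact ⟨hmem, h, hcon⟩)) (not_le.2 hwt)
  obtain ⟨x₂, hx₂, hmax₂⟩ := (V.filter (· < t)).exists_max_image id ⟨c, by simp [hc, hct]⟩
  simp only [Finset.mem_filter, id] at hx₂ hmax₂
  have hcx₂ : c ≤ x₂ := hmax₂ c ⟨hc, hct⟩
  obtain ⟨x₁, hx₁, hbx₁⟩ := Consecutive.exists_pred hb hx₂.1 (hbc.trans_le hcx₂)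
  have hbx₂ := hbx₁.trans hx₁.lt.le
  have hx₁' : Consecutive V' x₁ x₂ := by
    refine ⟨(agree _ hbx₁ (hx₁.lt.trans hx₂.2)).1 hx₁.1, (agree _ hbx₂ hx₂.2).1 hx₂.1, hx₁.lt,
      fun d hd => ?_⟩
    by_contra hcon
    rw [not_or, not_le, not_le] at hcon
    have := hx₁.2.2.2 d ((agree d (hbx₁.trans hcon.1.le) (hcon.2.trans hx₂.2)).2 hd)
    exact this.elim (not_le.2 hcon.1) (not_le.2 hcon.2)
  by_cases htV : t ∈ V
  · have htV' : t ∉ V' := fun h => htne (iff_of_true htV h)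
    have h2 : Consecutive V x₂ t := ⟨hx₂.1, htV, hx₂.2, fun d hd => by
      rcases lt_or_ge d t with h | h
      · exact Or.inl (hmax₂ d ⟨hd, h⟩)
      · exact Or.inr h⟩
    obtain ⟨y', hy', -⟩ := Consecutive.exists_succ hx₁'.2.1 hy (hx₂.2.trans_le
      (hmin y (by simp [hy, hcy, hyV])))
    exact htV' (hS.right_unique (hV _ _ _ hx₁ h2) (hV' _ _ _ hx₁' hy') ▸ hy'.2.1)
  · have htV' : t ∈ V' := by tauto
    have h2 : Consecutive V' x₂ t := ⟨hx₁'.2.1, htV', hx₂.2, fun d hd => by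
      rcases lt_or_ge d t with h | h
      · rcases le_or_gt d x₂ with h' | h'
        · exact Or.inl h'
        · exact Or.inl (hmax₂ d ⟨(agree d (hbx₂.trans h'.le) h).2 hd, h⟩)
      · exact Or.inr h⟩
    have hSt := hV' _ _ _ hx₁' h2
    by_cases hex : ∃ v ∈ V, t ≤ v
    · obtain ⟨v, hv, htv⟩ := hex
      obtain ⟨y', hy', -⟩ := Consecutive.exists_succ hx₂.1 hv (hx₂.2.trans_le htv)
      exact htV (hS.right_unique hSt (hV _ _ _ hx₁ hy') ▸ hy'.2.1)
    · push Not at hex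
      have hle : ∀ z ∈ insert t V, z ≤ t := fun z hz =>
        (Finset.mem_insert.1 hz).elim (fun h => h.le) fun h => (hex z h).le
      have old : ∀ p q, Consecutive (insert t V) p q → q ≠ t → Consecutive V p q := by
        intro p q hpq hqt
        have hp : p ≠ t := fun h => absurd (hle q hpq.2.1) (not_le.2 (h ▸ hpq.lt))
        exact ⟨Finset.mem_of_mem_insert_of_ne hpq.1 hp, Finset.mem_of_mem_insert_of_ne hpq.2.1 hqt,
          hpq.lt, fun d hd => hpq.2.2.2 d (Finset.mem_insert_of_mem hd)⟩
      refine htV (hmax t fun p q r hpq hqr => ?_)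
      have hqt : q ≠ t := fun h => absurd (hle r hqr.2.1) (not_le.2 (h ▸ hqr.lt))
      have hpq' := old p q hpq hqt
      by_cases hrt : r = t
      · subst hrt
        have hq : q = x₂ := by
          refine le_antisymm (hmax₂ q ⟨hpq'.2.1, hqr.lt⟩) ?_
          exact (hqr.2.2.2 x₂ (by simp [hx₂.1])).resolve_right (not_le.2 hx₂.2)
        subst hq
        have hp : p = x₁ := by
          refine le_antisymm ?_ ?_
          · exact (hx₁.2.2.2 p hpq'.1).resolve_right (not_le.2 hpq'.lt)
          · exact (hpq'.2.2.2 x₁ hx₁.1).resolve_right (not_le.2 hx₁.lt)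
        subst hp
        exact hSt
      · exact hV _ _ _ hpq' (old q r hqr hrt)

theorem mem_of_maximal_left [Finite ι] (hS : A.IsFlipRel S) (hV : IsTripleChain S V)
    (hmax : ∀ y, IsTripleChain S (insert y V) → y ∈ V) {V' : Finset ι} (hV' : IsTripleChain S V')
    {b c y : ι} (hbc : b < c) (hb : b ∈ V) (hc : c ∈ V)
    (hagree : ∀ w, b ≤ w → w ≤ c → (w ∈ V ↔ w ∈ V')) (hy : y ∈ V') (hyb : y < b) : y ∈ V := by
  by_contra hyV
  have hne : ((V ∪ V').filter fun t => t < b ∧ ¬ (t ∈ V ↔ t ∈ V')).Nonempty :=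
    ⟨y, by simp [hy, hyb, hyV]⟩
  obtain ⟨t, ht, hmin⟩ := Finset.exists_max_image _ id hne
  simp only [Finset.mem_filter] at ht
  obtain ⟨-, htb, htne⟩ := ht
  have agree : ∀ w, w ≤ c → t < w → (w ∈ V ↔ w ∈ V') := by
    intro w hwc htw
    rcases le_or_gt b w with h | h
    · exact hagree w h hwc
    · by_contra hcon
      have hmem : w ∈ V ∪ V' := by
        rw [Finset.mem_union]; tauto
      exact absurd (hmin w (by simp only [Finset.mem_filter]; exact ⟨hmem, h, hcon⟩)) (not_le.2 htw)
  obtain ⟨x₂, hx₂, hmax₂⟩ := (V.filter (t < ·)).exists_min_image id ⟨b, by simp [hb, htb]⟩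
  simp only [Finset.mem_filter, id] at hx₂ hmax₂
  have hx₂b : x₂ ≤ b := hmax₂ b ⟨hb, htb⟩
  obtain ⟨x₁, hx₁, hx₁c⟩ := Consecutive.exists_succ hx₂.1 hc (hx₂b.trans_lt hbc)
  have hx₂c := hx₁.lt.le.trans hx₁c
  have hx₁' : Consecutive V' x₂ x₁ := by
    refine ⟨(agree _ hx₂c hx₂.2).1 hx₂.1, (agree _ hx₁c (hx₂.2.trans hx₁.lt)).1 hx₁.2.1, hx₁.lt,
      fun d hd => ?_⟩
    by_contra hcon
    rw [not_or, not_le, not_le] at hcon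
    have := hx₁.2.2.2 d ((agree d (hcon.2.le.trans hx₁c) (hx₂.2.trans hcon.1)).2 hd)
    exact this.elim (not_le.2 hcon.1) (not_le.2 hcon.2)
  by_cases htV : t ∈ V
  · have htV' : t ∉ V' := fun h => htne (iff_of_true htV h)
    have h2 : Consecutive V t x₂ := ⟨htV, hx₂.1, hx₂.2, fun d hd => by
      rcases lt_or_ge t d with h | h
      · exact Or.inr (hmax₂ d ⟨hd, h⟩)
      · exact Or.inl h⟩
    obtain ⟨y', hy', -⟩ := Consecutive.exists_pred hy hx₁'.1 (lt_of_le_of_lt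
      (hmin y (by simp [hy, hyb, hyV])) hx₂.2)
    exact htV' (hS.left_unique (hV _ _ _ h2 hx₁) (hV' _ _ _ hy' hx₁') ▸ hy'.1)
  · have htV' : t ∈ V' := by tauto
    have h2 : Consecutive V' t x₂ := ⟨htV', hx₁'.1, hx₂.2, fun d hd => by
      rcases lt_or_ge t d with h | h
      · rcases le_or_gt x₂ d with h' | h'
        · exact Or.inr h'
        · exact Or.inr (hmax₂ d ⟨(agree d (h'.le.trans hx₂c) h).2 hd, h⟩)
      · exact Or.inl h⟩
    have hSt := hV' _ _ _ h2 hx₁'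
    by_cases hex : ∃ v ∈ V, v ≤ t
    · obtain ⟨v, hv, htv⟩ := hex
      obtain ⟨y', hy', -⟩ := Consecutive.exists_pred hv hx₂.1 (htv.trans_lt hx₂.2)
      exact htV (hS.left_unique hSt (hV _ _ _ hy' hx₁) ▸ hy'.1)
    · push Not at hex
      have hle : ∀ z ∈ insert t V, t ≤ z := fun z hz =>
        (Finset.mem_insert.1 hz).elim (fun h => h.ge) fun h => (hex z h).le
      have old : ∀ p q, Consecutive (insert t V) p q → p ≠ t → Consecutive V p q := by
        intro p q hpq hpt
        have hq : q ≠ t := fun h => absurd (hle p hpq.1) (not_le.2 (h ▸ hpq.lt))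
        exact ⟨Finset.mem_of_mem_insert_of_ne hpq.1 hpt, Finset.mem_of_mem_insert_of_ne hpq.2.1 hq,
          hpq.lt, fun d hd => hpq.2.2.2 d (Finset.mem_insert_of_mem hd)⟩
      refine htV (hmax t fun p q r hpq hqr => ?_)
      have hqt : q ≠ t := fun h => absurd (hle p hpq.1) (not_le.2 (h ▸ hpq.lt))
      have hqr' := old q r hqr hqt
      by_cases hpt : p = t
      · subst hpt
        have hq : q = x₂ := by
          refine le_antisymm ?_ (hmax₂ q ⟨hqr'.1, hpq.lt⟩)
          exact (hpq.2.2.2 x₂ (by simp [hx₂.1])).resolve_left (not_le.2 hx₂.2)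
        subst hq
        obtain rfl : r = x₁ := hqr'.right_unique hx₁
        exact hSt
      · exact hV _ _ _ (old p q hpq hpt) hqr'

/-- The triple `i < j < k` is inverted. -/
def Inv (A : Pseudolines ι) (i j k : ι) : Prop := A.c j k < A.c i j

theorem not_inv_iff {i j k : ι} (hij : i < j) (hjk : j < k) :
    ¬ A.Inv i j k ↔ A.c i j < A.c j k := by
  rw [Inv, not_lt]
  exact ⟨fun h => lt_of_le_of_ne h (A.c_ne hij hjk), le_of_lt⟩

theorem inv_isConvexRel : IsConvexRel A.Inv := by
  intro i j k l hij hjk hkl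
  refine ⟨fun h1 h3 => ?_, fun h1 h4 => ?_, fun h2 h4 => ?_⟩
  · have a1 := A.c_gt_of_gt hij hjk h1
    have a3 := A.c_gt_of_gt (hij.trans hjk) hkl h3
    have h : A.c i l < A.c i j := a3.2.trans a1.2
    have : A.c j l < A.c i l := by
      rw [← A.gt_iff (hjk.trans hkl), ← A.f_c (hij.trans (hjk.trans hkl)), A.lt_iff hij]
      exact h
    exact this.trans h
  · have a1 := A.c_gt_of_gt hij hjk h1
    have a4 := A.c_gt_of_gt hjk hkl h4
    exact ⟨a4.2.trans h1, h4.trans a1.1⟩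
  · have a2 := A.c_gt_of_gt hij (hjk.trans hkl) h2
    have a4 := A.c_gt_of_gt hjk hkl h4
    have h : A.c k l < A.c i l := a4.1.trans a2.1
    have : A.c i l < A.c i k := by
      rw [← A.lt_iff (hij.trans hjk), A.f_c (hij.trans (hjk.trans hkl)), A.gt_iff hkl]
      exact h
    exact h.trans this

theorem not_inv_isConvexRel : IsConvexRel fun i j k => ¬ A.Inv i j k := by
  intro i j k l hij hjk hkl
  have hik := hij.trans hjk
  have hjl := hjk.trans hkl
  simp only [not_inv_iff hij hjk, not_inv_iff hik hkl, not_inv_iff hij hjl, not_inv_iff hjk hkl]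
  refine ⟨fun h1 h3 => ?_, fun h1 h4 => ?_, fun h2 h4 => ?_⟩
  · have a1 := A.c_lt_of_lt hij hjk h1
    have a3 := A.c_lt_of_lt hik hkl h3
    rw [← A.lt_iff hjl, ← A.f_c hij, A.lt_iff (hij.trans hjl)]
    linarith
  · have a1 := A.c_lt_of_lt hij hjk h1
    have a4 := A.c_lt_of_lt hjk hkl h4
    exact ⟨by linarith, by linarith⟩
  · have a2 := A.c_lt_of_lt hij hjl h2
    have a4 := A.c_lt_of_lt hjk hkl h4
    rw [← A.gt_iff hik, A.f_c hkl, A.gt_iff (hik.trans hkl)]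
    linarith

end Pseudolines

/-! ### Adding triples to a consistent set -/

theorem IsConvexRel.congr {ι : Type*} [LinearOrder ι] {R R' : ι → ι → ι → Prop}
    (hR : IsConvexRel R) (h : ∀ i j k, i < j → j < k → (R i j k ↔ R' i j k)) : IsConvexRel R' := by
  intro i j k l hij hjk hkl
  rw [← h _ _ _ hij hjk, ← h _ _ _ (hij.trans hjk) hkl, ← h _ _ _ hij (hjk.trans hkl),
    ← h _ _ _ hjk hkl]
  exact hR i j k l hij hjk hkl

/-- Adding a single triple to a convex and coconvex relation. -/
theorem isConvexRel_insert_iff {ι : Type*} [LinearOrder ι] {P : ι → ι → ι → Prop}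
    (hP : IsConvexRel P) (hP' : IsConvexRel fun i j k => ¬ P i j k) {a b d : ι} (hab : a < b)
    (hbd : b < d) (hn : ¬ P a b d) :
    (IsConvexRel (fun i j k => P i j k ∨ (i = a ∧ j = b ∧ k = d)) ∧
      IsConvexRel (fun i j k => ¬ (P i j k ∨ (i = a ∧ j = b ∧ k = d)))) ↔
    ∀ q, (q < a → (P q a b ↔ P q b d) ∧ (P q a b ↔ P q a d)) ∧
      (a < q → q < b → (P a q b ↔ ¬ P q b d) ∧ (P a q b ↔ P a q d)) ∧
      (b < q → q < d → (¬ P a b q ↔ P b q d) ∧ (¬ P a b q ↔ P a q d)) ∧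
      (d < q → (P a b q ↔ P b d q) ∧ (P a b q ↔ P a d q)) := by
  constructor
  · rintro ⟨h, h'⟩ q
    refine ⟨fun h1 => ?_, fun h1 h2 => ?_, fun h1 h2 => ?_, fun h1 => ?_⟩
    · have g1 := h q a b d h1 hab hbd
      have g2 := h' q a b d h1 hab hbd
      have g3 := hP q a b d h1 hab hbd
      have g4 := hP' q a b d h1 hab hbd
      simp only [h1.ne, hab.ne, hbd.ne, false_and, or_false, and_self,
        or_true, not_true_eq_false] at g1 g2 g3 g4
      clear h h' hP hP'
      grind
    · have g1 := h a q b d h1 h2 hbd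
      have g2 := h' a q b d h1 h2 hbd
      have g3 := hP a q b d h1 h2 hbd
      have g4 := hP' a q b d h1 h2 hbd
      simp only [h1.ne', h2.ne, hbd.ne, false_and, and_false, or_false, and_self,
        or_true, not_true_eq_false] at g1 g2 g3 g4
      clear h h' hP hP'
      grind
    · have g1 := h a b q d hab h1 h2
      have g2 := h' a b q d hab h1 h2
      have g3 := hP a b q d hab h1 h2
      have g4 := hP' a b q d hab h1 h2
      simp only [h1.ne', h2.ne, hab.ne', false_and, and_false, or_false, and_self,
        or_true, not_true_eq_false] at g1 g2 g3 g4
      clear h h' hP hP'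
      grind
    · have g1 := h a b d q hab hbd h1
      have g2 := h' a b d q hab hbd h1
      have g3 := hP a b d q hab hbd h1
      have g4 := hP' a b d q hab hbd h1
      simp only [h1.ne', hab.ne', hbd.ne', and_false, or_false, and_self,
        or_true, not_true_eq_false] at g1 g2 g3 g4
      clear h h' hP hP'
      grind
  · intro h
    have key : ∀ i j k l, i < j → j < k → k < l →
        (i = a ∧ j = b ∧ k = d) ∨ (i = a ∧ j = b ∧ l = d) ∨ (i = a ∧ k = b ∧ l = d) ∨
        (j = a ∧ k = b ∧ l = d) ∨ (¬ (i = a ∧ j = b ∧ k = d) ∧ ¬ (i = a ∧ j = b ∧ l = d) ∧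
          ¬ (i = a ∧ k = b ∧ l = d) ∧ ¬ (j = a ∧ k = b ∧ l = d)) := by
      intro i j k l _ _ _; tauto
    constructor
    all_goals
      intro i j k l hij hjk hkl
      have g3 := hP i j k l hij hjk hkl
      have g4 := hP' i j k l hij hjk hkl
      rcases key i j k l hij hjk hkl with ⟨rfl, rfl, rfl⟩ | ⟨rfl, rfl, rfl⟩ | ⟨rfl, rfl, rfl⟩ |
        ⟨rfl, rfl, rfl⟩ | ⟨n1, n2, n3, n4⟩
      · have := (h l).2.2.2 hkl
        simp only [hij.ne', hjk.ne', hkl.ne', and_false, or_false, and_self,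
          or_true, not_true_eq_false] at g3 g4 this ⊢
        clear h hP hP' key
        grind
      · have := (h k).2.2.1 hjk hkl
        simp only [hij.ne', hjk.ne', hkl.ne, false_and, and_false, or_false, and_self,
          or_true, not_true_eq_false] at g3 g4 this ⊢
        clear h hP hP' key
        grind
      · have := (h j).2.1 hij hjk
        simp only [hij.ne', hjk.ne, hkl.ne, false_and, and_false, or_false, and_self,
          or_true, not_true_eq_false] at g3 g4 this ⊢
        clear h hP hP' key
        grind
      · have := (h i).1 hij
        simp only [hij.ne, hjk.ne, hkl.ne, false_and, or_false, and_self,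
          or_true, not_true_eq_false] at g3 g4 this ⊢
        clear h hP hP' key
        grind
      · simp only [n1, n2, n3, n4, or_false]
        first | exact g3 | exact g4

namespace Pseudolines

variable {ι : Type*} [LinearOrder ι] {A : Pseudolines ι} {S : ι → ι → ι → Prop} {V : Finset ι}

/-- For each further wire `q`, `isConvexRel_insert_iff` gives two equivalences. Translated according
to the place of `q` among a, b, d, they say that the three vertices lie on the same side of `q`. -/
theorem isFlip_iff {a b d : ι} (hab : a < b) (hbd : b < d) (hn : ¬ A.Inv a b d) :
    A.IsFlip a b d ↔
      (IsConvexRel (fun i j k => A.Inv i j k ∨ (i = a ∧ j = b ∧ k = d)) ∧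
      IsConvexRel (fun i j k => ¬ (A.Inv i j k ∨ (i = a ∧ j = b ∧ k = d)))) := by
  rw [isConvexRel_insert_iff inv_isConvexRel not_inv_isConvexRel hab hbd hn]
  have left : ∀ {q u v : ι}, q < u → u < v → (A.Above q u v ↔ ¬ A.Inv q u v) := fun h h' => by
    rw [A.above_iff_left h, not_inv_iff h h']
  have right : ∀ {q u v : ι}, u < v → v < q → (A.Above q u v ↔ ¬ A.Inv u v q) := fun h h' => by
    rw [A.above_iff_right h h', not_inv_iff h h']
  have mid : ∀ {q u v : ι}, u < q → q < v → (A.Above q u v ↔ A.Inv u q v) := fun h h' =>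
    A.above_iff_mid h h'
  constructor
  · rintro ⟨-, -, -, h⟩ q
    refine ⟨fun h1 => ?_, fun h1 h2 => ?_, fun h1 h2 => ?_, fun h1 => ?_⟩
    · have := h q h1.ne (h1.trans hab).ne (h1.trans (hab.trans hbd)).ne
      rw [left h1 hab, left (h1.trans hab) hbd, left h1 (hab.trans hbd)] at this
      exact ⟨not_iff_not.1 this.1, not_iff_not.1 this.2⟩
    · have := h q h1.ne' h2.ne (h2.trans hbd).ne
      rw [mid h1 h2, left h2 hbd, mid h1 (h2.trans hbd)] at this
      exact this
    · have := h q (hab.trans h1).ne' h1.ne' h2.ne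
      rw [right hab h1, mid h1 h2, mid (hab.trans h1) h2] at this
      exact this
    · have := h q (hab.trans (hbd.trans h1)).ne' (hbd.trans h1).ne' h1.ne'
      rw [right hab (hbd.trans h1), right hbd h1, right (hab.trans hbd) h1] at this
      exact ⟨not_iff_not.1 this.1, not_iff_not.1 this.2⟩
  · intro h
    refine ⟨hab, hbd, (not_inv_iff hab hbd).1 hn, fun q hqa hqb hqd => ?_⟩
    obtain ⟨g1, g2, g3, g4⟩ := h q
    clear h
    rcases hqa.lt_or_gt with h1 | h1
    · rw [left h1 hab, left (h1.trans hab) hbd, left h1 (hab.trans hbd)]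
      have := g1 h1
      exact ⟨not_congr this.1, not_congr this.2⟩
    rcases hqb.lt_or_gt with h2 | h2
    · rw [mid h1 h2, left h2 hbd, mid h1 (h2.trans hbd)]
      exact g2 h1 h2
    rcases hqd.lt_or_gt with h3 | h3
    · rw [right hab h2, mid h2 h3, mid (hab.trans h2) h3]
      exact g3 h2 h3
    · rw [right hab (hbd.trans h3), right hbd h3, right (hab.trans hbd) h3]
      have := g4 h3
      exact ⟨not_congr this.1, not_congr this.2⟩

/-- Adding all triples of a maximal chain which no pseudoline cuts. -/
theorem isConvexRel_union_chain [Finite ι] (hS : A.IsFlipRel S) (hV : IsTripleChain S V)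
    (hmax : ∀ y, IsTripleChain S (insert y V) → y ∈ V)
    (huncut : ∀ q, q ∉ V → (∀ a ∈ V, ∀ b ∈ V, a < b → A.Above q a b) ∨
      (∀ a ∈ V, ∀ b ∈ V, a < b → ¬ A.Above q a b))
    {Z : ι → ι → ι → Prop} (hZ : IsConvexRel Z) (hZ' : IsConvexRel fun i j k => ¬ Z i j k)
    (hXZ : ∀ i j k, i < j → j < k → A.Inv i j k → Z i j k)
    (hZS : ∀ i j k, i < j → j < k → Z i j k → A.Inv i j k ∨ A.Spanned S i j k) :
    IsConvexRel (fun i j k => Z i j k ∨ (i ∈ V ∧ j ∈ V ∧ k ∈ V)) ∧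
    IsConvexRel (fun i j k => ¬ (Z i j k ∨ (i ∈ V ∧ j ∈ V ∧ k ∈ V))) := by
  have inv_of : ∀ {i j k : ι}, i < j → j < k → ¬ (A.c i j < A.c j k) → Z i j k :=
    fun hij hjk h => hXZ _ _ _ hij hjk (by rwa [← not_inv_iff hij hjk, not_not] at h)
  -- In the order ijk, ijl, ikl, jkl, a closed and coclosed set has an initial or final segment of
  -- triples. The clauses keep this true after adding the triple that omits l, k, j or i,
  -- respectively.
  have bits : ∀ i j k l, i < j → j < k → k < l →
      (i ∈ V → j ∈ V → k ∈ V → l ∉ V → (Z i j l ∧ Z i k l ∧ Z j k l) ∨ ¬ Z j k l) ∧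
      (i ∈ V → j ∈ V → k ∉ V → l ∈ V → Z i j k ∨ (Z i k l ∧ Z j k l)) ∧
      (i ∈ V → j ∉ V → k ∈ V → l ∈ V → (Z i j k ∧ Z i j l) ∨ Z j k l) ∧
      (i ∉ V → j ∈ V → k ∈ V → l ∈ V → (Z i j k ∧ Z i j l ∧ Z i k l) ∨ ¬ Z i j k) := by
    intro i j k l hij hjk hkl
    have hik := hij.trans hjk
    have hjl := hjk.trans hkl
    refine ⟨fun hi hj hk hl => ?_, fun hi hj hk hl => ?_, fun hi hj hk hl => ?_,
      fun hi hj hk hl => ?_⟩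
    · rcases huncut l hl with h | h
      · right
        intro hz
        have hn := (A.above_iff_right hjk hkl).1 (h j hj k hk hjk)
        -- The triple is not inverted, so it is spanned by a chain from `j` to `l`. This chain
        -- agrees with `V` on [j, k], and maximality then puts `l` into `V`.
        rcases hZS _ _ _ hjk hkl hz with h' | ⟨-, -, -, V', hV', hjV', hlV', hVs', hkV'⟩
        · exact lt_asymm h' hn
        · have hagree := chains_agree hS ((hV.filter_le k).filter_ge i) hV' hij hjk hkl
            (chain_not_inverted hS hV hi hj hk hij hjk) hn (by simp [hi, hik.le])
            (by simp [hk, hik.le]) (fun v hv => by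
              simp only [Finset.mem_filter] at hv; exact ⟨hv.2, hv.1.2⟩) hjV' hlV' hVs'
            (Or.inl (by simp [hj, hij.le, hjk.le])) hkV'
          refine hl (mem_of_maximal_right hS hV hmax hV' hjk hj hk (fun w h1 h2 => ?_) hlV' hkl)
          rw [← hagree w h1 h2]
          simp [h2, hij.le.trans h1]
      · left
        have h1 := h i hi j hj hij
        have h2 := h i hi k hk hik
        have h3 := h j hj k hk hjk
        rw [A.above_iff_right hij hjl] at h1
        rw [A.above_iff_right hik hkl] at h2
        rw [A.above_iff_right hjk hkl] at h3
        exact ⟨inv_of hij hjl h1, inv_of hik hkl h2, inv_of hjk hkl h3⟩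
    · rcases huncut k hk with h | h
      · exact Or.inr ⟨hXZ _ _ _ hik hkl ((A.above_iff_mid hik hkl).1 (h i hi l hl (hik.trans hkl))),
          hXZ _ _ _ hjk hkl ((A.above_iff_mid hjk hkl).1 (h j hj l hl hjl))⟩
      · left
        have h1 := h i hi j hj hij
        rw [A.above_iff_right hij hjk] at h1
        exact inv_of hij hjk h1
    · rcases huncut j hj with h | h
      · exact Or.inl ⟨hXZ _ _ _ hij hjk ((A.above_iff_mid hij hjk).1 (h i hi k hk hik)),
          hXZ _ _ _ hij hjl ((A.above_iff_mid hij hjl).1 (h i hi l hl (hij.trans hjl)))⟩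
      · right
        have h1 := h k hk l hl hkl
        rw [A.above_iff_left hjk] at h1
        exact inv_of hjk hkl h1
    · rcases huncut i hi with h | h
      · right
        intro hz
        have hn := (A.above_iff_left hij).1 (h j hj k hk hjk)
        rcases hZS _ _ _ hij hjk hz with h' | ⟨-, -, -, V', hV', hiV', hkV', hVs', hjV'⟩
        · exact lt_asymm h' hn
        · have hagree := chains_agree hS hV' ((hV.filter_le l).filter_ge j) hij hjk hkl
            hn (chain_not_inverted hS hV hj hk hl hjk hkl) hiV' hkV' hVs' (by simp [hj, hjl.le])
            (by simp [hl, hjl.le]) (fun v hv => by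
              simp only [Finset.mem_filter] at hv; exact ⟨hv.2, hv.1.2⟩) hjV'
            (Or.inl (by simp [hk, hkl.le, hjk.le]))
          refine hi (mem_of_maximal_left hS hV hmax hV' hjk hj hk (fun w h1 h2 => ?_) hiV' hij)
          rw [hagree w h1 h2]
          simp [h1, h2.trans hkl.le]
      · left
        have h1 := h j hj k hk hjk
        have h2 := h j hj l hl hjl
        have h3 := h k hk l hl hkl
        rw [A.above_iff_left hij] at h1 h2
        rw [A.above_iff_left hik] at h3
        exact ⟨inv_of hij hjk h1, inv_of hij hjl h2, inv_of hik hkl h3⟩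
  constructor
  all_goals
    intro i j k l hij hjk hkl
    obtain ⟨b1, b2, b3, b4⟩ := bits i j k l hij hjk hkl
    obtain ⟨g1, g2, g3⟩ := hZ i j k l hij hjk hkl
    obtain ⟨g1', g2', g3'⟩ := hZ' i j k l hij hjk hkl
    by_cases m1 : i ∈ V <;> by_cases m2 : j ∈ V <;> by_cases m3 : k ∈ V <;> by_cases m4 : l ∈ V <;>
    simp only [m1, m2, m3, m4, true_and, and_true, false_and, and_false, or_true, or_false,
      forall_const, not_true_eq_false, not_false_eq_true, IsEmpty.forall_iff] at b1 b2 b3 b4 ⊢ <;>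
    clear bits huncut hXZ hZS hZ hZ' hmax hV hS inv_of <;>
    grind

end Pseudolines

/-! ### Families of triples as ternary relations -/

section Families

variable {n : ℕ}

/-- The ternary relation of a family of triples. -/
def tripleRel (X : Set (Finset (Fin n))) (i j k : Fin n) : Prop := ({i, j, k} : Finset (Fin n)) ∈ X

theorem card_triple {i j k : Fin n} (hij : i < j) (hjk : j < k) :
    ({i, j, k} : Finset (Fin n)).card = 3 :=
  Finset.card_eq_three.2 ⟨i, j, k, hij.ne, (hij.trans hjk).ne, hjk.ne, rfl⟩

theorem exists_sorted_triple {I : Finset (Fin n)} (hI : I.card = 3) :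
    ∃ i j k, i < j ∧ j < k ∧ I = {i, j, k} := by
  refine ⟨I.orderEmbOfFin hI 0, I.orderEmbOfFin hI 1, I.orderEmbOfFin hI 2, by simp, by simp, ?_⟩
  refine (Finset.image_orderEmbOfFin_univ I hI).symm.trans ?_
  ext x
  simp only [Finset.mem_image, Finset.mem_univ, true_and, Fin.exists_fin_succ, Finset.mem_insert,
    Finset.mem_singleton, eq_comm (a := x)]
  simp

theorem sorted_triple_inj {i j k a b d : Fin n} (hij : i < j) (hjk : j < k) (hab : a < b)
    (hbd : b < d) : ({i, j, k} : Finset (Fin n)) = {a, b, d} ↔ i = a ∧ j = b ∧ k = d := by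
  constructor
  · intro h
    have h1 : ∀ x, (x = i ∨ x = j ∨ x = k) ↔ (x = a ∨ x = b ∨ x = d) := fun x => by
      have := Finset.ext_iff.1 h x
      simpa using this
    have hi := (h1 i).1 (Or.inl rfl)
    have hj := (h1 j).1 (Or.inr (Or.inl rfl))
    have hk := (h1 k).1 (Or.inr (Or.inr rfl))
    have ha := (h1 a).2 (Or.inl rfl)
    have hd := (h1 d).2 (Or.inr (Or.inr rfl))
    omega
  · rintro ⟨rfl, rfl, rfl⟩; rfl

theorem tripleRel_compl {X : Set (Finset (Fin n))} {i j k : Fin n} (hij : i < j) (hjk : j < k) :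
    tripleRel (kSubsets n (2 + 1) \ X) i j k ↔ ¬ tripleRel X i j k := by
  simp [tripleRel, kSubsets, card_triple hij hjk]

/-- Here the common part is a single point; its four possible positions in a four-element set yield
the implications of `IsConvexRel`. -/
theorem isClosedFamily_two_iff {X : Set (Finset (Fin n))} :
    IsClosedFamily 2 X ↔ X ⊆ kSubsets n 3 ∧ IsConvexRel (tripleRel X) := by
  have e1 : ∀ p i j : Fin n, ({p} ∪ {i, j} : Finset (Fin n)) = {p, i, j} := fun _ _ _ => rfl
  have e2 : ∀ p i j : Fin n, ({p} ∪ {i, j} : Finset (Fin n)) = {i, p, j} := fun p i j => by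
    rw [e1]; exact Finset.insert_comm _ _ _
  have e3 : ∀ p i j : Fin n, ({p} ∪ {i, j} : Finset (Fin n)) = {i, j, p} := fun p i j => by
    rw [e2, Finset.pair_comm]
  refine and_congr Iff.rfl
    ⟨fun h i j k l hij hjk hkl => ?_, fun h I i j k hI hi hj hk hij hjk => ?_⟩
  · have hik := hij.trans hjk
    have hjl := hjk.trans hkl
    have hil := hij.trans hjl
    have h1 := h {i} j k l rfl (by simp [hij.ne']) (by simp [hik.ne']) (by simp [hil.ne']) hjk hkl
    have h2 := h {j} i k l rfl (by simp [hij.ne]) (by simp [hjk.ne']) (by simp [hjl.ne']) hik hkl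
    have h3 := h {k} i j l rfl (by simp [hik.ne]) (by simp [hjk.ne]) (by simp [hkl.ne']) hij hjl
    have h4 := h {l} i j k rfl (by simp [hil.ne]) (by simp [hjl.ne]) (by simp [hkl.ne]) hij hjk
    rw [e1, e1, e1] at h1
    rw [e2, e1, e2] at h2
    rw [e3, e2, e2] at h3
    rw [e3, e3, e3] at h4
    exact ⟨h1, fun a b => ⟨h2 a b, h3 a b⟩, h4⟩
  · obtain ⟨p, rfl⟩ := Finset.card_eq_one.1 (by omega : I.card = 1)
    rw [Finset.mem_singleton] at hi hj hk
    rcases Ne.lt_or_gt hi with hi | hi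
    · rcases Ne.lt_or_gt hj with hj | hj
      · rcases Ne.lt_or_gt hk with hk | hk
        · rw [e3, e3, e3]
          exact (h i j k p hij hjk hk).2.2
        · rw [e3, e2, e2]
          exact fun a b => ((h i j p k hij hj hk).2.1 a b).2
      · rw [e2, e1, e2]
        exact fun a b => ((h i p j k hi hj hjk).2.1 a b).1
    · rw [e1, e1, e1]
      exact (h p i j k hi hij hjk).1

theorem isConsistent_two_iff {X : Set (Finset (Fin n))} :
    IsConsistent 2 X ↔ X ⊆ kSubsets n 3 ∧ IsConvexRel (tripleRel X) ∧
      IsConvexRel fun i j k => ¬ tripleRel X i j k := by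
  rw [IsConsistent, isClosedFamily_two_iff, isClosedFamily_two_iff]
  constructor
  · rintro ⟨⟨h1, h2⟩, -, h3⟩
    exact ⟨h1, h2, h3.congr fun i j k hij hjk => tripleRel_compl hij hjk⟩
  · rintro ⟨h1, h2, h3⟩
    exact ⟨⟨h1, h2⟩, Set.sdiff_subset, h3.congr fun i j k hij hjk => (tripleRel_compl hij hjk).symm⟩

theorem subset_familyClosure (d : ℕ) (X : Set (Finset (Fin n))) : X ⊆ familyClosure d X :=
  Set.subset_sInter fun _ hZ => hZ.2

theorem familyClosure_subset {d : ℕ} {X Z : Set (Finset (Fin n))} (hZ : IsClosedFamily d Z)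
    (hXZ : X ⊆ Z) : familyClosure d X ⊆ Z :=
  Set.sInter_subset_of_mem ⟨hZ, hXZ⟩

theorem familyClosure_mono {d : ℕ} {X Z : Set (Finset (Fin n))} (hXZ : X ⊆ Z) :
    familyClosure d X ⊆ familyClosure d Z :=
  Set.sInter_subset_sInter fun _ hU => ⟨hU.1, hXZ.trans hU.2⟩

theorem familyClosure_empty (d : ℕ) : familyClosure d (∅ : Set (Finset (Fin n))) = ∅ :=
  Set.subset_empty_iff.1 (familyClosure_subset
    ⟨Set.empty_subset _, fun _ _ _ _ _ _ _ _ _ _ h _ => h⟩ (Set.empty_subset _))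

theorem isClosedFamily_familyClosure {X : Set (Finset (Fin n))} (hX : X ⊆ kSubsets n 3) :
    IsClosedFamily 2 (familyClosure 2 X) := by
  refine ⟨familyClosure_subset ⟨subset_rfl, fun I i j k hI hi hj hk hij hjk _ _ => ?_⟩ hX,
    fun I i j k hI hi hj hk hij hjk h1 h2 => Set.mem_sInter.2 fun Z hZ =>
      hZ.1.2 I i j k hI hi hj hk hij hjk (h1 Z hZ) (h2 Z hZ)⟩
  obtain ⟨p, rfl⟩ := Finset.card_eq_one.1 (by omega : I.card = 1)
  rw [Finset.mem_singleton] at hi hk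
  exact Finset.card_eq_three.2 ⟨p, i, k, Ne.symm hi, Ne.symm hk, (hij.trans hjk).ne, rfl⟩

end Families

/-! ### Wiring diagrams as arrangements -/

namespace WiringDiagram

variable {n : ℕ} (W : WiringDiagram n)

theorem continuous_wire (i : Fin n) : Continuous (W.wire i) := (W.piecewiseLinear i).1

/-- The first coordinate of the crossing of two wires. -/
noncomputable def crossing (i j : Fin n) : ℝ :=
  -- The value for equal wires is arbitrary; every use concerns distinct ones.
  if h : i ≠ j then (W.existsUnique_crossing i j h).choose else 0

theorem wire_eq_iff {i j : Fin n} (h : i ≠ j) (x : ℝ) :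
    W.wire i x = W.wire j x ↔ x = W.crossing i j := by
  have hs := (W.existsUnique_crossing i j h).choose_spec
  rw [crossing, dif_pos h]
  exact ⟨fun hx => hs.2 x hx, fun hx => hx ▸ hs.1⟩

theorem exists_crossing_mem {i j : Fin n} (h : i ≠ j) {x y : ℝ} (hxy : x ≤ y)
    (hx : W.wire i x ≤ W.wire j x) (hy : W.wire j y ≤ W.wire i y) :
    x ≤ W.crossing i j ∧ W.crossing i j ≤ y := by
  obtain ⟨z, hz, he⟩ := isPreconnected_Icc.intermediate_value₂ (Set.left_mem_Icc.2 hxy)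
    (Set.right_mem_Icc.2 hxy) (W.continuous_wire i).continuousOn (W.continuous_wire j).continuousOn
    hx hy
  rw [W.wire_eq_iff h] at he
  exact he ▸ hz

theorem exists_crossing_mem' {i j : Fin n} (h : i ≠ j) {x y : ℝ} (hxy : x ≤ y)
    (hx : W.wire j x ≤ W.wire i x) (hy : W.wire i y ≤ W.wire j y) :
    x ≤ W.crossing i j ∧ W.crossing i j ≤ y := by
  obtain ⟨z, hz, he⟩ := isPreconnected_Icc.intermediate_value₂ (Set.left_mem_Icc.2 hxy)
    (Set.right_mem_Icc.2 hxy) (W.continuous_wire j).continuousOn (W.continuous_wire i).continuousOn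
    hx hy
  rw [eq_comm, W.wire_eq_iff h] at he
  exact he ▸ hz

theorem wire_lt_of_crossing_lt {i j : Fin n} (h : i < j) {x : ℝ} (hx : W.crossing i j < x) :
    W.wire j x < W.wire i x := by
  by_contra hcon
  obtain ⟨y, hy, hxy⟩ := ((W.order_right i j h).and (eventually_ge_atTop x)).exists
  exact absurd (W.exists_crossing_mem h.ne hxy (not_lt.1 hcon) hy.le).1 (not_le.2 hx)

/-- By transversality, `i` is below `j` either just to the left of the crossing, so that a reversed
order at `x` would force a second crossing, or just to the right, against the known order there. -/
theorem wire_lt_of_lt_crossing {i j : Fin n} (h : i < j) {x : ℝ} (hx : x < W.crossing i j) :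
    W.wire i x < W.wire j x := by
  by_contra hcon
  rcases W.transverse i j _ h.ne ((W.wire_eq_iff h.ne _).2 rfl) with ⟨h1, -⟩ | ⟨-, h2⟩
  · obtain ⟨y, ⟨hy, hxy⟩, hy'⟩ := ((h1.and (eventually_nhdsWithin_of_eventually_nhds
      (eventually_ge_nhds hx))).and self_mem_nhdsWithin).exists
    exact absurd (W.exists_crossing_mem' h.ne hxy (not_lt.1 hcon) hy.le).2 (not_le.2 hy')
  · obtain ⟨y, hy, hy'⟩ := (h2.and self_mem_nhdsWithin).exists
    exact lt_asymm hy (W.wire_lt_of_crossing_lt h hy')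

/-- The arrangement of a simple wiring diagram. -/
noncomputable def toPseudolines (hW : W.IsSimple) : Pseudolines (Fin n) where
  f := W.wire
  c := W.crossing
  lt_iff {a b} h x := by
    refine ⟨fun hx => ?_, W.wire_lt_of_lt_crossing h⟩
    by_contra hcon
    rcases (not_lt.1 hcon).eq_or_lt with he | hlt
    · exact hx.ne ((W.wire_eq_iff h.ne x).2 he.symm)
    · exact lt_asymm hx (W.wire_lt_of_crossing_lt h hlt)
  gt_iff {a b} h x := by
    refine ⟨fun hx => ?_, W.wire_lt_of_crossing_lt h⟩
    by_contra hcon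
    rcases (not_lt.1 hcon).eq_or_lt with he | hlt
    · exact hx.ne' ((W.wire_eq_iff h.ne x).2 he)
    · exact lt_asymm hx (W.wire_lt_of_lt_crossing h hlt)
  simple {i j k} hij hjk hik x h h' := hW i j k hij hjk hik x ⟨h, h'⟩

variable {W}

theorem tripleRel_inversionSet (hW : W.IsSimple) {i j k : Fin n} (hij : i < j) (hjk : j < k) :
    tripleRel W.inversionSet i j k ↔ (W.toPseudolines hW).Inv i j k := by
  have hik := hij.trans hjk
  rw [Pseudolines.Inv, ← Pseudolines.above_iff_mid _ hij hjk]
  constructor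
  · rintro ⟨a, b, d, hab, hbd, he, x, hx, hlt⟩
    obtain ⟨rfl, rfl, rfl⟩ := (sorted_triple_inj hij hjk hab hbd).1 he
    rw [W.wire_eq_iff hik.ne] at hx
    subst hx
    exact hlt
  · intro h
    exact ⟨i, j, k, hij, hjk, rfl, _, (W.wire_eq_iff hik.ne _).2 rfl, h⟩

/-- Two wires cross once, so running below both ends of the floor means running below all of it. -/
theorem height_triple (hW : W.IsSimple) {i j k : Fin n} (hij : i < j) (hjk : j < k)
    (hn : ¬ (W.toPseudolines hW).Inv i j k) :
    W.height {i, j, k} = ((W.toPseudolines hW).belowFloor i j k).ncard := by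
  have hlt : W.crossing i j < W.crossing j k := (Pseudolines.not_inv_iff hij hjk).1 hn
  rw [height]
  congr 1
  ext p
  constructor
  · rintro ⟨a, b, d, hab, hbd, he, h⟩
    obtain ⟨rfl, rfl, rfl⟩ := (sorted_triple_inj hij hjk hab hbd).1 he
    have h1 := (W.wire_eq_iff hij.ne (W.crossing i j)).2 rfl
    have h2 := ((W.wire_eq_iff hjk.ne (W.crossing j k)).2 rfl).symm
    exact ⟨h (W.crossing i j, _) ⟨rfl, _, _, h1, h2, Set.left_mem_uIcc⟩,
      h (W.crossing j k, _) ⟨rfl, _, _, h1, h2, Set.right_mem_uIcc⟩⟩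
  · rintro ⟨h1, h2⟩
    refine ⟨i, j, k, hij, hjk, rfl, ?_⟩
    rintro ⟨x, y⟩ ⟨hz, a, b, ha, hb, hmem⟩
    rw [W.wire_eq_iff hij.ne] at ha
    rw [eq_comm, W.wire_eq_iff hjk.ne] at hb
    subst ha hb
    rw [Set.uIcc_of_le hlt.le] at hmem
    simp only at hz hmem ⊢
    rw [hz]
    exact (W.toPseudolines hW).between hmem.1 hmem.2 h1 h2

theorem union_singleton_mem_higherBruhat_iff (hW : W.IsSimple) {a b d : Fin n}
    (hab : a < b) (hbd : b < d)
    (hn : ¬ (W.toPseudolines hW).Inv a b d) :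
    W.inversionSet ∪ {{a, b, d}} ∈ higherBruhat n 2 ↔ (W.toPseudolines hW).IsFlip a b d := by
  have hrel : ∀ i j k : Fin n, i < j → j < k →
      (tripleRel (W.inversionSet ∪ {{a, b, d}}) i j k ↔
        (W.toPseudolines hW).Inv i j k ∨ (i = a ∧ j = b ∧ k = d)) := by
    intro i j k hij hjk
    rw [← tripleRel_inversionSet hW hij hjk, ← sorted_triple_inj hij hjk hab hbd]
    exact Iff.rfl
  rw [Pseudolines.isFlip_iff hab hbd hn]
  change IsConsistent 2 _ ↔ _
  rw [isConsistent_two_iff]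
  constructor
  · rintro ⟨-, h1, h2⟩
    exact ⟨h1.congr hrel, h2.congr fun i j k hij hjk => not_congr (hrel i j k hij hjk)⟩
  · rintro ⟨h1, h2⟩
    refine ⟨?_, h1.congr fun i j k hij hjk => (hrel i j k hij hjk).symm,
      h2.congr fun i j k hij hjk => not_congr (hrel i j k hij hjk).symm⟩
    rintro I (⟨i, j, k, hij, hjk, rfl, -⟩ | rfl)
    · exact card_triple hij hjk
    · exact card_triple hab hbd

theorem inversionSet_mem_higherBruhat (hW : W.IsSimple) : W.inversionSet ∈ higherBruhat n 2 := by
  have hrel := fun (i j k : Fin n) (hij : i < j) (hjk : j < k) =>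
    tripleRel_inversionSet hW hij hjk
  refine isConsistent_two_iff.2 ⟨?_,
    Pseudolines.inv_isConvexRel.congr fun i j k hij hjk => (hrel i j k hij hjk).symm,
    Pseudolines.not_inv_isConvexRel.congr fun i j k hij hjk => not_congr (hrel i j k hij hjk).symm⟩
  rintro I ⟨i, j, k, hij, hjk, rfl, -⟩
  exact card_triple hij hjk

theorem mem_ascents_iff (hW : W.IsSimple) {Y : Set (Finset (Fin n))} {a b d : Fin n}
    (hab : a < b) (hbd : b < d) :
    {a, b, d} ∈ ascents 2 W.inversionSet Y ↔
      tripleRel Y a b d ∧ (W.toPseudolines hW).IsFlip a b d := by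
  constructor
  · rintro ⟨⟨h1, h2⟩, h3⟩
    have hn : ¬ (W.toPseudolines hW).Inv a b d := fun h =>
      h2 ((tripleRel_inversionSet hW hab hbd).2 h)
    exact ⟨h1, (union_singleton_mem_higherBruhat_iff hW hab hbd hn).1 h3⟩
  · rintro ⟨h1, h2⟩
    have hn := (Pseudolines.not_inv_iff hab hbd).2 h2.2.2.1
    exact ⟨⟨h1, fun h => hn ((tripleRel_inversionSet hW hab hbd).1 h)⟩,
      (union_singleton_mem_higherBruhat_iff hW hab hbd hn).2 h2⟩

/-- An ascent of maximum height can be added to every set of ascents whose closure gives a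
consistent set. -/
theorem union_familyClosure_insert_mem (hW : W.IsSimple) {Y : Set (Finset (Fin n))}
    (hY : Y ∈ higherBruhat n 2)
    (hXY : W.inversionSet ⊆ Y) {I₀ : Finset (Fin n)} (hI₀ : I₀ ∈ ascents 2 W.inversionSet Y)
    (hmax : ∀ J ∈ ascents 2 W.inversionSet Y, W.height J ≤ W.height I₀)
    {T : Set (Finset (Fin n))} (hT : T ⊆ ascents 2 W.inversionSet Y)
    (hZ : W.inversionSet ∪ familyClosure 2 T ∈ higherBruhat n 2) :
    W.inversionSet ∪ familyClosure 2 (T ∪ {I₀}) ∈ higherBruhat n 2 := by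
  set A := W.toPseudolines hW with hA
  set X := W.inversionSet with hX
  obtain ⟨hYk, hYc, hYc'⟩ := isConsistent_two_iff.1 hY
  obtain ⟨hZk, hZc, hZc'⟩ := isConsistent_two_iff.1 hZ
  obtain ⟨u, v, w, huv, hvw, rfl⟩ := exists_sorted_triple (hYk hI₀.1.1)
  have hT' : T ∪ {{u, v, w}} ⊆ ascents 2 X Y :=
    Set.union_subset hT (Set.singleton_subset_iff.2 hI₀)
  -- `tripleRel` ignores the order of its arguments, so increasing order is imposed separately.
  let S : Fin n → Fin n → Fin n → Prop := fun a b d =>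
    a < b ∧ b < d ∧ tripleRel (T ∪ {{u, v, w}}) a b d
  have hSflip : ∀ a b d, S a b d → tripleRel Y a b d ∧ A.IsFlip a b d := fun a b d h =>
    (mem_ascents_iff hW h.1 h.2.1).1 (hT' h.2.2)
  have hS : A.IsFlipRel S := fun a b d h => by
    obtain ⟨h1, h2, h3, h4⟩ := (hSflip a b d h).2
    exact ⟨h1, h2, h3, fun q hqa hqb hqd => (h4 q hqa hqb hqd).1⟩
  have hSuvw : S u v w := ⟨huv, hvw, Or.inr rfl⟩
  have hV₀ : IsTripleChain S ({u, v, w} : Finset (Fin n)) := by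
    intro a b d hab hbd
    have h1 := hab.1
    have h2 := hab.2.1
    have h3 := hbd.2.1
    have h4 := hab.lt
    have h5 := hbd.lt
    simp only [Finset.mem_insert, Finset.mem_singleton] at h1 h2 h3
    have : a = u ∧ b = v ∧ d = w := by omega
    obtain ⟨rfl, rfl, rfl⟩ := this
    exact hSuvw
  obtain ⟨V, hV₀V, hVmax⟩ :=
    (Set.toFinite {V : Finset (Fin n) | IsTripleChain S V}).exists_le_maximal hV₀
  have hV : IsTripleChain S V := hVmax.1
  have hmaxV : ∀ y, IsTripleChain S (insert y V) → y ∈ V := fun y hy =>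
    hVmax.2 hy (Finset.subset_insert y V) (Finset.mem_insert_self y V)
  have hu : u ∈ V := hV₀V (by simp)
  have hv : v ∈ V := hV₀V (by simp)
  have hw : w ∈ V := hV₀V (by simp)
  have hXY' : ∀ i j k, i < j → j < k → A.c j k < A.c i j → tripleRel Y i j k :=
    fun i j k hij hjk h => hXY ((tripleRel_inversionSet hW hij hjk).2 h)
  -- Maximality of the height enters only here, through `above_of_hi`.
  have huncut : ∀ q, q ∉ V → (∀ a ∈ V, ∀ b ∈ V, a < b → A.Above q a b) ∨
      (∀ a ∈ V, ∀ b ∈ V, a < b → ¬ A.Above q a b) := by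
    intro q hq
    rcases Pseudolines.hi_or_lo hS hV hq with h | h
    · refine Or.inl fun a ha b hb hab => Pseudolines.above_of_hi hS hV hYc hYc' hXY'
        (fun i j k h => (hSflip i j k h).1) hu hv hw hSuvw (fun a b d hf hYabd => ?_) hq h ha hb hab
      have h1 := hmax _ ((mem_ascents_iff hW hf.1 hf.2.1).2 ⟨hYabd, hf⟩)
      rwa [height_triple hW hf.1 hf.2.1 ((Pseudolines.not_inv_iff hf.1 hf.2.1).2 hf.2.2.1),
        height_triple hW huv hvw ((Pseudolines.not_inv_iff huv hvw).2
          (hSflip _ _ _ hSuvw).2.2.2.1)] at h1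
    · exact Or.inr fun a ha b hb hab habove => lt_asymm habove
        (h.lt hS hV (A.inRange_crossing hS hV ha hb hab) ha)
  have hTk : T ⊆ kSubsets n 3 := fun I hI => hYk (hT hI).1.1
  have hTk' : T ∪ {{u, v, w}} ⊆ kSubsets n 3 := fun I hI => hYk (hT' hI).1.1
  -- The spanned triples form a closed family containing `T`, each element of `T` being a chain by
  -- itself.
  have hspan : familyClosure 2 T ⊆
      {I | ∃ i j k, I = {i, j, k} ∧ A.Spanned S i j k} := by
    refine familyClosure_subset (isClosedFamily_two_iff.2 ⟨?_, ?_⟩) fun I hI => ?_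
    · rintro I ⟨i, j, k, rfl, h⟩
      exact card_triple h.1 h.2.1
    · refine (Pseudolines.spanned_isConvexRel hS).congr fun i j k hij hjk => ?_
      refine ⟨fun h => ⟨i, j, k, rfl, h⟩, ?_⟩
      rintro ⟨a, b, d, he, h⟩
      obtain ⟨rfl, rfl, rfl⟩ := (sorted_triple_inj hij hjk h.1 h.2.1).1 he
      exact h
    · obtain ⟨i, j, k, hij, hjk, rfl⟩ := exists_sorted_triple (hTk hI)
      refine ⟨i, j, k, rfl, Pseudolines.spanned_of_mem hS (V := {i, j, k}) ?_ (by simp) (by simp)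
        (by simp) hij hjk⟩
      intro a b d hab hbd
      have h1 := hab.1
      have h2 := hab.2.1
      have h3 := hbd.2.1
      have h4 := hab.lt
      have h5 := hbd.lt
      simp only [Finset.mem_insert, Finset.mem_singleton] at h1 h2 h3
      have : a = i ∧ b = j ∧ d = k := by omega
      obtain ⟨rfl, rfl, rfl⟩ := this
      exact ⟨hij, hjk, Or.inl hI⟩
  obtain ⟨hc, hc'⟩ := Pseudolines.isConvexRel_union_chain hS hV hmaxV huncut hZc hZc'
    (fun i j k hij hjk h => Or.inl ((tripleRel_inversionSet hW hij hjk).2 h))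
    (fun i j k hij hjk h => by
      rcases h with h | h
      · exact Or.inl ((tripleRel_inversionSet hW hij hjk).1 h)
      · obtain ⟨a, b, d, he, h⟩ := hspan h
        obtain ⟨rfl, rfl, rfl⟩ := (sorted_triple_inj hij hjk h.1 h.2.1).1 he
        exact Or.inr h)
  let Z' : Set (Finset (Fin n)) := (X ∪ familyClosure 2 T) ∪ {I | I.card = 3 ∧ I ⊆ V}
  have hrel : ∀ i j k : Fin n, i < j → j < k → ((tripleRel (X ∪ familyClosure 2 T) i j k ∨
      (i ∈ V ∧ j ∈ V ∧ k ∈ V)) ↔ tripleRel Z' i j k) := by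
    intro i j k hij hjk
    refine or_congr Iff.rfl ?_
    simp [card_triple hij hjk, Finset.insert_subset_iff]
  have hZ' : IsConsistent 2 Z' := isConsistent_two_iff.2
    ⟨Set.union_subset hZk fun I hI => hI.1, hc.congr hrel,
      hc'.congr fun i j k hij hjk => not_congr (hrel i j k hij hjk)⟩
  -- `Z'` is closed and contains the generators; conversely, the consecutive triples of `V` are
  -- generators, and closedness yields all its triples.
  have heq : X ∪ familyClosure 2 (T ∪ {{u, v, w}}) = Z' := by
    apply Set.Subset.antisymm
    · refine Set.union_subset (fun I hI => Or.inl (Or.inl hI)) (familyClosure_subset hZ'.1 ?_)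
      refine Set.union_subset (fun I hI => Or.inl (Or.inr (subset_familyClosure 2 T hI))) ?_
      rw [Set.singleton_subset_iff]
      exact Or.inr ⟨card_triple huv hvw, by simp [Finset.insert_subset_iff, hu, hv, hw]⟩
    · refine Set.union_subset (Set.union_subset_union_right _
        (familyClosure_mono Set.subset_union_left)) ?_
      rintro I ⟨hI, hIV⟩
      obtain ⟨i, j, k, hij, hjk, rfl⟩ := exists_sorted_triple hI
      have hcl := (isClosedFamily_two_iff.1 (isClosedFamily_familyClosure hTk')).2
      refine Or.inr (hcl.of_consecutive (V := V)
        (fun a b d hab hbd => subset_familyClosure 2 _ (hV _ _ _ hab hbd).2.2)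
        (hIV (by simp)) (hIV (by simp)) (hIV (by simp)) hij hjk)
  rw [heq]
  exact hZ'

end WiringDiagram

theorem mainTheorem4 (n : ℕ) (W : WiringDiagram n) (hW : W.IsSimple)
    (X Y : Set (Finset (Fin n))) (hX : W.inversionSet = X)
    (hY : Y ∈ higherBruhat n 2) (hXY : X ⊂ Y)
    (I₀ : Finset (Fin n)) (hI₀ : I₀ ∈ ascents 2 X Y)
    (hmax : ∀ J ∈ ascents 2 X Y, W.height J ≤ W.height I₀) :
    (∀ 𝓘 : Set (Finset (Fin n)), 𝓘 ⊆ ascents 2 X Y →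
      X ∪ familyClosure 2 𝓘 ∈ higherBruhat n 2 →
      X ∪ familyClosure 2 (𝓘 ∪ {I₀}) ∈ higherBruhat n 2) ∧
    IsConePoint (ascentComplex 2 X Y) I₀ := by
  subst hX
  have main : ∀ T : Set (Finset (Fin n)), T ⊆ ascents 2 W.inversionSet Y →
      W.inversionSet ∪ familyClosure 2 T ∈ higherBruhat n 2 →
      W.inversionSet ∪ familyClosure 2 (T ∪ {I₀}) ∈ higherBruhat n 2 := fun T hT hZ =>
    WiringDiagram.union_familyClosure_insert_mem hW hY hXY.1 hI₀ hmax hT hZ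
  have hempty : W.inversionSet ∪ familyClosure 2 (((∅ : Finset (Finset (Fin n))) :
      Set (Finset (Fin n)))) ∈ higherBruhat n 2 := by
    rw [Finset.coe_empty, familyClosure_empty, Set.union_empty]
    exact WiringDiagram.inversionSet_mem_higherBruhat hW
  have extend : ∀ σ : Finset (Finset (Fin n)),
      (σ : Set (Finset (Fin n))) ⊆ ascents 2 W.inversionSet Y →
      (∀ τ ⊆ σ, W.inversionSet ∪ familyClosure 2 (τ : Set (Finset (Fin n))) ∈ higherBruhat n 2) →
      insert I₀ σ ∈ (ascentComplex 2 W.inversionSet Y).faces := by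
    intro σ hσ hτ
    refine ⟨Finset.insert_nonempty _ _, ?_, fun τ hτσ => ?_⟩
    · rw [Finset.coe_insert]
      exact Set.insert_subset hI₀ hσ
    · have hsub : τ.erase I₀ ⊆ σ := Finset.subset_insert_iff.1 hτσ
      by_cases h : I₀ ∈ τ
      · have := main (τ.erase I₀ : Finset (Finset (Fin n)))
          ((Finset.coe_subset.2 hsub).trans hσ) (hτ _ hsub)
        rwa [Set.union_singleton, ← Finset.coe_insert, Finset.insert_erase h] at this
      · rw [Finset.erase_eq_of_notMem h] at hsub
        exact hτ τ hsub
  refine ⟨main, ?_, fun σ hσ => extend σ hσ.2.1 hσ.2.2⟩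
  refine extend ∅ (by simp) fun τ hτ => ?_
  rw [Finset.subset_empty.1 hτ]
  exact hempty
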